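/- Let $\mathcal{K}=\mathbb{C}(\!(t)\!)$ with the derivation $d=t\frac{d}{dt}$. For an integer $b\ge 1$ let $\mathcal{K}_b=\mathbb{C}(\!(t^{1/b})\!)\supseteq\mathcal{K}$, and let $d_b$ be the derivation of $\mathcal{K}_b$ that extends $d$; that is, $d_b=\frac1b\, s\frac{d}{ds}$ where $s=t^{1/b}$. A formal differential operator is an additive map $D:V\to V$ on a finite-dimensional $\mathcal{K}$-vector space $V$ such that $D(av)=aD(v)+d(a)v$ for all $a\in\mathcal{K}$ and $v\in V$. Its base change to $\mathcal{K}_b$ is the additive map $D_b$ on $V_b=V\otimes_{\mathcal{K}}\mathcal{K}_b$ determined by $D_b(v\otimes c)=D(v)\otimes c+v\otimes d_b(c)$. **Corollary 1.10.** Let $D:V\to V$ be a formal differential operator with $V\neq 0$. Then $D$ has an eigenvalue after a suitable finite base change: there exist an integer $b\ge 1$, an element $a\in\mathcal{K}_b$ and a nonzero vector $v\in V_b$ such that $D_b v=a v$. -/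

import Mathlib

noncomputable section

namespace FormalDiff

open scoped TensorProduct

/-- The field `𝒦 = ℂ((t))` of formal Laurent series. -/
def K : Type := LaurentSeries ℂ

instance : Field K := inferInstanceAs (Field (LaurentSeries ℂ))

/-- The variable of `ℂ((t))`. -/
def t : LaurentSeries ℂ := HahnSeries.single 1 1

/-- The map `f ↦ t * (df/dt)` multiplies the `n`-th coefficient by `n`. -/
theorem coeff_t_mul_derivative (f : LaurentSeries ℂ) (n : ℤ) :
    (t * LaurentSeries.derivative ℂ f).coeff n = (n : ℂ) * f.coeff n := by
  have h := HahnSeries.coeff_single_mul_add (r := (1 : ℂ))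
    (x := LaurentSeries.derivative ℂ f) (a := n - 1) (b := 1)
  rw [sub_add_cancel] at h
  rw [t, h]
  simp

/-- The Leibniz rule for `t d/dt`. -/
theorem t_mul_derivative_mul (f g : LaurentSeries ℂ) :
    t * LaurentSeries.derivative ℂ (f * g) =
      f * (t * LaurentSeries.derivative ℂ g) + g * (t * LaurentSeries.derivative ℂ f) := by
  have hsupp : ∀ h : LaurentSeries ℂ, (t * LaurentSeries.derivative ℂ h).support ⊆ h.support := by
    intro h i hi
    rw [HahnSeries.mem_support, coeff_t_mul_derivative] at hi
    exact right_ne_zero_of_mul hi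
  rw [mul_comm g]
  ext n
  rw [coeff_t_mul_derivative, HahnSeries.coeff_add, HahnSeries.coeff_mul,
    HahnSeries.coeff_mul_right' g.isPWO_support (hsupp g),
    HahnSeries.coeff_mul_left' f.isPWO_support (hsupp f), Finset.mul_sum,
    ← Finset.sum_add_distrib]
  refine Finset.sum_congr rfl fun ij hij => ?_
  obtain ⟨-, -, rfl⟩ := Finset.mem_antidiagonal.mp hij
  rw [coeff_t_mul_derivative, coeff_t_mul_derivative]
  push_cast
  ring

/-- A differential ring structure from an additive map that satisfies the Leibniz rule. -/
@[reducible]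
def differentialOfLeibniz {R : Type*} [CommRing R] (δ : R →+ R)
    (h : ∀ f g, δ (f * g) = f * δ g + g * δ f) : Differential R :=
  ⟨Derivation.mk' δ.toIntLinearMap h⟩

/-- The map `t d/dt` on `ℂ((t))`. -/
def euler : LaurentSeries ℂ →+ LaurentSeries ℂ :=
  (AddMonoidHom.mulLeft t).comp (LaurentSeries.derivative ℂ).toAddMonoidHom

/-- `𝒦` is a differential field with the derivation `d = t d/dt`. -/
instance : Differential K := differentialOfLeibniz (R := K) euler t_mul_derivative_mul

/-- The field `𝒦_b = ℂ((t^{1/b}))`, for `b ≥ 1`: the formal Laurent series in a variable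
`s = t^{1/b}`, so that the coefficient of index `n` is that of `t^{n/b}`. It is a type of its own
since it is regarded as an extension of `𝒦` through `t = s^b`. -/
def Kb (_b : ℕ+) : Type := LaurentSeries ℂ

instance (b : ℕ+) : Field (Kb b) := inferInstanceAs (Field (LaurentSeries ℂ))

/-- The inclusion `ℂ((t)) → ℂ((t^{1/b}))`, which sends `∑ aₙ tⁿ` to `∑ aₙ s^{b n}`. -/
def inclusion (b : ℕ+) : LaurentSeries ℂ →+* LaurentSeries ℂ :=
  HahnSeries.embDomainRingHom (AddMonoidHom.mulLeft (b : ℤ))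
    (fun _ _ h => mul_left_cancel₀ (by exact_mod_cast b.ne_zero) h)
    (fun _ _ => mul_le_mul_iff_right₀ (by exact_mod_cast b.pos))

instance (b : ℕ+) : Algebra K (Kb b) :=
  RingHom.toAlgebra (R := K) (S := Kb b) (inclusion b)

/-- The map `d_b = (1/b) s d/ds` on `ℂ((s))`, where `s = t^{1/b}`. -/
def eulerRoot (b : ℕ+) : LaurentSeries ℂ →+ LaurentSeries ℂ :=
  (AddMonoidHom.mulLeft (HahnSeries.C ((b : ℂ)⁻¹))).comp euler

theorem eulerRoot_mul (b : ℕ+) (f g : LaurentSeries ℂ) :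
    eulerRoot b (f * g) = f * eulerRoot b g + g * eulerRoot b f := by
  have h : euler (f * g) = f * euler g + g * euler f := t_mul_derivative_mul f g
  simp only [eulerRoot, AddMonoidHom.comp_apply, AddMonoidHom.coe_mulLeft, h]
  ring

/-- `𝒦_b` is a differential field with the derivation `d_b`. -/
instance (b : ℕ+) : Differential (Kb b) :=
  differentialOfLeibniz (R := Kb b) (eulerRoot b) (eulerRoot_mul b)

theorem coeff_eulerRoot (b : ℕ+) (f : LaurentSeries ℂ) (n : ℤ) :
    (eulerRoot b f).coeff n = (b : ℂ)⁻¹ * ((n : ℂ) * f.coeff n) := by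
  rw [← coeff_t_mul_derivative]
  exact HahnSeries.coeff_single_zero_mul

/-- The derivation `d_b` extends the derivation `d`. -/
theorem eulerRoot_inclusion (b : ℕ+) (f : LaurentSeries ℂ) :
    eulerRoot b (inclusion b f) = inclusion b (euler f) := by
  have hcoe : ∀ (g : LaurentSeries ℂ) (n : ℤ), (inclusion b g).coeff ((b : ℤ) * n) = g.coeff n :=
    fun g n => HahnSeries.embDomain_mk_coeff _ _
  ext n
  rw [coeff_eulerRoot]
  by_cases hn : ∃ m : ℤ, (b : ℤ) * m = n
  · obtain ⟨m, rfl⟩ := hn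
    have hb : (b : ℂ) ≠ 0 := by exact_mod_cast b.ne_zero
    rw [hcoe, hcoe]
    refine Eq.trans ?_ (coeff_t_mul_derivative f m).symm
    push_cast
    field_simp
  · have hzero : ∀ g : LaurentSeries ℂ, (inclusion b g).coeff n = 0 :=
      fun g => HahnSeries.embDomain_of_notMem_range (by
        rintro ⟨m, hm⟩
        exact hn ⟨m, hm⟩)
    rw [hzero, hzero, mul_zero, mul_zero]

instance (b : ℕ+) : DifferentialAlgebra K (Kb b) := ⟨eulerRoot_inclusion b⟩

/-- A differential operator on a vector space `V` over a differential field `F` is an additive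
map `D : V → V` with `D (a v) = a D(v) + a′ v`. A formal differential operator is one
over `F = 𝒦`. -/
structure DifferentialOperator (F : Type*) [Field F] [Differential F]
    (V : Type*) [AddCommGroup V] [Module F V] where
  toAddMonoidHom : V →+ V
  leibniz : ∀ (a : F) (v : V),
    toAddMonoidHom (a • v) = a • toAddMonoidHom v + Differential.deriv a • v

namespace DifferentialOperator

instance {F : Type*} [Field F] [Differential F] {V : Type*} [AddCommGroup V] [Module F V] :
    CoeFun (DifferentialOperator F V) (fun _ => V → V) :=
  ⟨fun D => D.toAddMonoidHom⟩

/-- A nonzero vector `v` is an eigenvector of `D` with eigenvalue `a` if `D v = a v`. -/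
def IsEigenvector {F : Type*} [Field F] [Differential F] {V : Type*} [AddCommGroup V]
    [Module F V] (D : DifferentialOperator F V) (a : F) (v : V) : Prop :=
  v ≠ 0 ∧ D v = a • v

/-- `a` is an eigenvalue of `D` if it has an eigenvector. -/
def IsEigenvalue {F : Type*} [Field F] [Differential F] {V : Type*} [AddCommGroup V]
    [Module F V] (D : DifferentialOperator F V) (a : F) : Prop :=
  ∃ v : V, D.IsEigenvector a v

variable {V : Type*} [AddCommGroup V] [Module K V]

/-- The additive map on `𝒦_b ⊗ V` with `c ⊗ v ↦ d_b(c) ⊗ v + c ⊗ D(v)`. -/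
def baseChangeHom (D : DifferentialOperator K V) (b : ℕ+) : Kb b ⊗[K] V →+ Kb b ⊗[K] V :=
  TensorProduct.liftAddHom
    (AddMonoidHom.mk' (fun c : Kb b => AddMonoidHom.mk'
        (fun v : V => Differential.deriv c ⊗ₜ[K] v + c ⊗ₜ[K] D v)
        (fun v w => by simp only [map_add, TensorProduct.tmul_add]; abel))
      (fun c c' => by
        ext v
        simp only [AddMonoidHom.mk'_apply, AddMonoidHom.add_apply, map_add,
          TensorProduct.add_tmul]
        abel))
    (fun r c v => by
      simp only [AddMonoidHom.mk'_apply]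
      rw [D.leibniz, Algebra.smul_def, Derivation.leibniz, deriv_algebraMap]
      simp only [smul_eq_mul, TensorProduct.add_tmul, TensorProduct.tmul_add]
      have e : ∀ (r : K) (c : Kb b) (w : V), (r • c) ⊗ₜ[K] w = c ⊗ₜ[K] (r • w) :=
        fun r c w => TensorProduct.smul_tmul r c w
      rw [mul_comm c, ← Algebra.smul_def, ← Algebra.smul_def, ← Algebra.smul_def, e, e, e]
      abel)

@[simp]
theorem baseChangeHom_tmul (D : DifferentialOperator K V) (b : ℕ+) (c : Kb b) (v : V) :
    D.baseChangeHom b (c ⊗ₜ[K] v) = Differential.deriv c ⊗ₜ[K] v + c ⊗ₜ[K] D v :=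
  rfl

/-- The base change `D_b` of a formal differential operator `D` on `V` to `𝒦_b`: the differential
operator on `V_b = 𝒦_b ⊗ V` over `(𝒦_b, d_b)` with `D_b (c ⊗ v) = d_b(c) ⊗ v + c ⊗ D(v)`. -/
def baseChange (D : DifferentialOperator K V) (b : ℕ+) :
    DifferentialOperator (Kb b) (Kb b ⊗[K] V) where
  toAddMonoidHom := D.baseChangeHom b
  leibniz a x := by
    induction x with
    | zero => simp
    | tmul c v =>
      rw [TensorProduct.smul_tmul', baseChangeHom_tmul, baseChangeHom_tmul, smul_add,
        TensorProduct.smul_tmul', TensorProduct.smul_tmul', TensorProduct.smul_tmul',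
        smul_eq_mul, Derivation.leibniz, TensorProduct.add_tmul]
      simp only [smul_eq_mul, mul_comm c]
      abel
    | add x y hx hy => rw [smul_add, map_add, hx, hy, map_add, smul_add, smul_add]; abel

end DifferentialOperator

end FormalDiff

end

/-!
Over the field of Puiseux series, the union `Puiseux` of the fields `ℂ((t^{1/b}))` inside the Hahn
series with rational exponents, no base change is needed any more: it suffices that every
differential operator `D` on a nonzero finite-dimensional space over `Puiseux` has an eigenvalue,
since an eigenvector and its eigenvalue involve finitely many series, which have a common
denominator `b` (`exists_common_denominator`).

Restricting to a minimal nonzero invariant subspace, let `D` be irreducible. Then every vector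
`v ≠ 0` is cyclic: the vectors `Dⁱ v` with `i ≤ n` form a basis (`IsIrreducible.exists_basis`).
Replacing `D` by some `D - f`, which does not affect the existence of an eigenvalue, one may assume
that `Dⁿ⁺¹ v = ∑ aᵢ Dⁱ v` with `aₙ = 0` (`exists_iter_twist_mem_krylov`). Let `ρ` be the largest
slope of the Newton polygon of this relation, or `0` if that is negative. Then `t^ρ D` preserves the
lattice spanned by the vectors `t^{iρ} Dⁱ v`.

* If `ρ = 0`, then `D` preserves a lattice, and an eigenvector of its residue, for an eigenvalue of
  minimal real part, lifts to an eigenvector of `D` (`exists_eigenvector_of_integral`).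
* If `ρ > 0`, then the residue of `t^ρ D` is a companion matrix with trace zero and nonzero last
  column. So it has two distinct eigenvalues, and the vectors on which `t^ρ D - λ` is topologically
  nilpotent, for one eigenvalue `λ`, form a proper nonzero subspace stable under `D`
  (`exists_stable_submodule`). This contradicts irreducibility.

Both lifting arguments are successive approximations in tuples of Laurent series in `t^{1/b}`, which
are complete for the filtration by order (`exists_limit_of_step`).
-/

noncomputable section

namespace FormalDiff

/-! ### Tuples of Laurent series: the filtration by order -/

section Order

variable {Γ R : Type*} [AddCommGroup Γ] [LinearOrder Γ] [IsOrderedAddMonoid Γ]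
  [NonUnitalNonAssocSemiring R]

theorem coeff_mul_eq_zero_of_lt {f g : HahnSeries Γ R} {p q m : Γ}
    (hf : ∀ j < p, f.coeff j = 0) (hg : ∀ j < q, g.coeff j = 0) (hm : m < p + q) :
    (f * g).coeff m = 0 := by
  rw [HahnSeries.coeff_mul]
  refine Finset.sum_eq_zero fun ij hij => ?_
  obtain ⟨-, -, h⟩ := Finset.mem_antidiagonal.mp hij
  rcases lt_or_ge ij.1 p with h1 | h1
  · rw [hf _ h1, zero_mul]
  · rw [hg ij.2, mul_zero]
    by_contra! h2
    exact absurd (add_le_add h1 h2) (not_le.mpr (h ▸ hm))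

theorem coeff_mul_add {f g : HahnSeries Γ R} {p q : Γ}
    (hf : ∀ j < p, f.coeff j = 0) (hg : ∀ j < q, g.coeff j = 0) :
    (f * g).coeff (p + q) = f.coeff p * g.coeff q := by
  rw [HahnSeries.coeff_mul]
  refine Finset.sum_eq_single (p, q) (fun ij hij hne => ?_) fun hpq => ?_
  · obtain ⟨-, -, h⟩ := Finset.mem_antidiagonal.mp hij
    rcases lt_or_ge ij.1 p with h1 | h1
    · rw [hf _ h1, zero_mul]
    · rw [hg ij.2, mul_zero]
      by_contra! h2
      obtain ⟨h3, h4⟩ := (add_eq_add_iff_eq_and_eq h1 h2).mp h.symm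
      exact hne (Prod.ext h3.symm h4.symm)
  · rw [Finset.mem_antidiagonal, HahnSeries.mem_support, HahnSeries.mem_support] at hpq
    by_contra! h
    exact hpq ⟨left_ne_zero_of_mul h, right_ne_zero_of_mul h, rfl⟩

end Order

variable {σ : Type*}

/-- The tuples of Laurent series all of whose entries have order at least `k`. -/
def filtration (σ : Type*) (k : ℤ) : AddSubgroup (σ → LaurentSeries ℂ) where
  carrier := {x | ∀ i, ∀ j < k, (x i).coeff j = 0}
  zero_mem' := fun _ _ _ => rfl
  add_mem' := fun {x y} hx hy i j hj => by
    rw [Pi.add_apply, HahnSeries.coeff_add, hx i j hj, hy i j hj, add_zero]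
  neg_mem' := fun {x} hx i j hj => by
    rw [Pi.neg_apply, HahnSeries.coeff_neg, hx i j hj, neg_zero]

/-- The tuple of the coefficients of index `k`; on `filtration σ k` its kernel is
`filtration σ (k + 1)`. -/
def coeffs (k : ℤ) : (σ → LaurentSeries ℂ) →+ (σ → ℂ) where
  toFun x i := (x i).coeff k
  map_zero' := rfl
  map_add' _ _ := rfl

@[simp]
theorem coeffs_apply (k : ℤ) (x : σ → LaurentSeries ℂ) (i : σ) : coeffs k x i = (x i).coeff k :=
  rfl

/-- The tuple with entries `uᵢ sᵏ`. -/
def monomialTuple (k : ℤ) (u : σ → ℂ) : σ → LaurentSeries ℂ := fun i => HahnSeries.single k (u i)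

theorem monomialTuple_mem (k : ℤ) (u : σ → ℂ) : monomialTuple k u ∈ filtration σ k :=
  fun _ _ hj => HahnSeries.coeff_single_of_ne hj.ne

@[simp]
theorem coeffs_monomialTuple (k : ℤ) (u : σ → ℂ) : coeffs k (monomialTuple k u) = u := by
  ext i
  simp [monomialTuple]

theorem filtration_anti {k l : ℤ} (h : k ≤ l) : filtration σ l ≤ filtration σ k :=
  fun _ hx i j hj => hx i j (hj.trans_le h)

theorem mem_filtration_succ {k : ℤ} {x : σ → LaurentSeries ℂ} (hx : x ∈ filtration σ k)
    (h : coeffs k x = 0) : x ∈ filtration σ (k + 1) := fun i j hj => by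
  rcases (Int.lt_add_one_iff.mp hj).lt_or_eq with h' | rfl
  · exact hx i j h'
  · exact congrFun h i

theorem coeffs_eq_zero {k : ℤ} {x : σ → LaurentSeries ℂ} (hx : x ∈ filtration σ (k + 1)) :
    coeffs k x = 0 :=
  funext fun i => hx i k (lt_add_one k)

theorem eq_zero_of_forall_mem_filtration {x : σ → LaurentSeries ℂ}
    (h : ∀ k : ℕ, x ∈ filtration σ k) : x = 0 := by
  ext i j
  exact h (j.toNat + 1) i j (by push_cast; have := Int.self_le_toNat j; omega)

theorem exists_mem_filtration [Finite σ] (x : σ → LaurentSeries ℂ) :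
    ∃ k : ℤ, x ∈ filtration σ k := by
  obtain ⟨k, hk⟩ := (Set.finite_range fun i => (x i).order).bddBelow
  exact ⟨k, fun i j hj =>
    HahnSeries.coeff_eq_zero_of_lt_order (hj.trans_le (hk ⟨i, rfl⟩))⟩

theorem smul_mem_filtration {k l : ℤ} {f : LaurentSeries ℂ} {x : σ → LaurentSeries ℂ}
    (hf : ∀ j < k, f.coeff j = 0) (hx : x ∈ filtration σ l) : f • x ∈ filtration σ (k + l) :=
  fun i _ hj => coeff_mul_eq_zero_of_lt hf (hx i) hj

/-- `filtration σ 0` is complete. -/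
theorem exists_limit (w : ℕ → σ → LaurentSeries ℂ) (h0 : w 0 ∈ filtration σ 0)
    (h : ∀ k : ℕ, w (k + 1) - w k ∈ filtration σ k) :
    ∃ x, ∀ k : ℕ, x - w k ∈ filtration σ k := by
  have hstab : ∀ k l : ℕ, k ≤ l → w l - w k ∈ filtration σ k := by
    intro k l hkl
    induction l, hkl using Nat.le_induction with
    | base => simp
    | succ l hkl ih =>
      rw [← sub_add_sub_cancel _ (w l)]
      exact add_mem (filtration_anti (by exact_mod_cast hkl) (h l)) ih
  refine ⟨fun i => HahnSeries.ofSuppBddBelow (fun j => (w (j.toNat + 1) i).coeff j)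
    ⟨0, fun j hj => ?_⟩, fun k i j hj => ?_⟩
  · by_contra! hj0
    refine hj ?_
    have h1 := hstab 0 (j.toNat + 1) (Nat.zero_le _) i j (by simpa using hj0)
    rw [Pi.sub_apply, HahnSeries.coeff_sub, h0 i j hj0, sub_zero] at h1
    exact h1
  · change (w (j.toNat + 1) i).coeff j - (w k i).coeff j = 0
    rcases le_total k (j.toNat + 1) with hk | hk
    · have := hstab _ _ hk i j hj
      rwa [Pi.sub_apply, HahnSeries.coeff_sub] at this
    · have := hstab _ _ hk i j (by push_cast; have := Int.self_le_toNat j; omega)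
      rwa [Pi.sub_apply, HahnSeries.coeff_sub, sub_eq_zero, eq_comm, ← sub_eq_zero] at this

/-- Successive approximation: a condition `G k` that can be passed on to `G (k + 1)` by a correction
of order `k` is satisfied in the limit. The start is at `k = 1`, so that the limit has the same
leading coefficients as `w₁`. -/
theorem exists_limit_of_step (G : ℕ → (σ → LaurentSeries ℂ) → Prop) {w₁ : σ → LaurentSeries ℂ}
    (hw₁ : w₁ ∈ filtration σ 0) (h1 : G 1 w₁)
    (hstep : ∀ k : ℕ, 1 ≤ k → ∀ w ∈ filtration σ 0, G k w →
      ∃ y ∈ filtration σ k, G (k + 1) (w + y)) :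
    ∃ x, x - w₁ ∈ filtration σ 1 ∧
      ∀ k : ℕ, 1 ≤ k → ∃ w ∈ filtration σ 0, G k w ∧ x - w ∈ filtration σ k := by
  have hstep' : ∀ (k : ℕ) (p : {w // w ∈ filtration σ 0 ∧ G (k + 1) w}),
      ∃ q : {w // w ∈ filtration σ 0 ∧ G (k + 1 + 1) w},
        (q : σ → LaurentSeries ℂ) - p ∈ filtration σ (k + 1 : ℕ) := by
    rintro k ⟨w, hw, hG⟩
    obtain ⟨y, hy, hG'⟩ := hstep (k + 1) (Nat.le_add_left 1 k) w hw hG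
    exact ⟨⟨w + y, add_mem hw (filtration_anti (by positivity) hy), hG'⟩, by simpa using hy⟩
  choose next hnext using hstep'
  let s : ∀ k : ℕ, {w // w ∈ filtration σ 0 ∧ G (k + 1) w} :=
    Nat.rec ⟨w₁, hw₁, h1⟩ next
  have hs : ∀ k : ℕ, (s (k + 1)).1 - (s k).1 ∈ filtration σ (k + 1 : ℕ) :=
    fun k => hnext k (s k)
  -- the terms are shifted by one, so that the `k`-th one satisfies `G k`
  obtain ⟨x, hx⟩ := exists_limit (fun k => (s (k - 1)).1) hw₁ (by
    rintro (_ | k)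
    · simp
    · exact hs k)
  exact ⟨x, by simpa [s] using hx 1, fun k hk => ⟨(s (k - 1)).1, (s (k - 1)).2.1,
    by simpa [Nat.sub_add_cancel hk] using (s (k - 1)).2.2, hx k⟩⟩

/-! ### Operators compatible with the filtration -/

section Operators

variable {T : AddMonoid.End (σ → LaurentSeries ℂ)}

/-- A map that preserves the filtration and acts on the `k`-th graded piece by `N k`, where `N 0` is
singular and the other `N k` are invertible, has a nonzero kernel. -/
theorem exists_ne_zero_map_eq_zero (N : ℕ → Module.End ℂ (σ → ℂ))
    (hT : ∀ (k : ℕ), ∀ x ∈ filtration σ k,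
      T x ∈ filtration σ k ∧ coeffs k (T x) = N k (coeffs k x))
    (h0 : ∃ u ≠ 0, N 0 u = 0) (hN : ∀ k, 1 ≤ k → Function.Surjective (N k)) :
    ∃ x ≠ 0, T x = 0 := by
  obtain ⟨u, hu, hu0⟩ := h0
  have hu' := hT 0 _ (monomialTuple_mem _ u)
  obtain ⟨x, hx1, hx⟩ := exists_limit_of_step (fun k w => T w ∈ filtration σ k)
    (monomialTuple_mem 0 u) (mem_filtration_succ hu'.1 (by
      rw [hu'.2, coeffs_monomialTuple, hu0])) (by
    intro k hk w hw hTw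
    obtain ⟨y, hy⟩ := hN k hk (-coeffs k (T w))
    have hy' := hT k _ (monomialTuple_mem _ y)
    refine ⟨monomialTuple k y, monomialTuple_mem _ y, ?_⟩
    rw [map_add]
    push_cast
    refine mem_filtration_succ (add_mem hTw hy'.1) ?_
    rw [map_add, hy'.2, coeffs_monomialTuple, hy, add_neg_cancel])
  refine ⟨x, ?_, ?_⟩
  · rintro rfl
    have := coeffs_eq_zero (k := 0) (by simpa using hx1)
    rw [coeffs_monomialTuple] at this
    exact hu this
  · refine eq_zero_of_forall_mem_filtration fun k => ?_
    obtain ⟨w, -, hTw, hxw⟩ := hx (k + 1) (Nat.le_add_left 1 k)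
    have h1 := (hT _ _ hxw).1
    rw [map_sub] at h1
    have h2 := add_mem h1 hTw
    rw [sub_add_cancel] at h2
    exact filtration_anti (by push_cast; omega) h2

variable {N : Module.End ℂ (σ → ℂ)}

theorem pow_mem_filtration (hT : ∀ (k : ℤ), ∀ x ∈ filtration σ k,
      T x ∈ filtration σ k ∧ coeffs k (T x) = N (coeffs k x)) (m : ℕ) {k : ℤ}
    {x : σ → LaurentSeries ℂ} (hx : x ∈ filtration σ k) :
    (T ^ m) x ∈ filtration σ k ∧ coeffs k ((T ^ m) x) = (N ^ m) (coeffs k x) := by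
  induction m with
  | zero => exact ⟨hx, rfl⟩
  | succ m ih =>
    rw [pow_succ', pow_succ']
    refine ⟨(hT _ _ ih.1).1, ?_⟩
    change coeffs k (T ((T ^ m) x)) = N ((N ^ m) (coeffs k x))
    rw [(hT _ _ ih.1).2, ih.2]

/-- Some power of `T` maps `x` to order at least `k`. -/
def EventuallyIn (T : AddMonoid.End (σ → LaurentSeries ℂ)) (k : ℤ) (x : σ → LaurentSeries ℂ) :
    Prop :=
  ∃ m : ℕ, (T ^ m) x ∈ filtration σ k

theorem EventuallyIn.of_map {k : ℤ} {x : σ → LaurentSeries ℂ} (h : EventuallyIn T k (T x)) :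
    EventuallyIn T k x := by
  obtain ⟨m, hm⟩ := h
  exact ⟨m + 1, by rw [pow_succ]; exact hm⟩

variable (hT : ∀ k : ℤ, ∀ x ∈ filtration σ k, T x ∈ filtration σ k)
include hT

theorem pow_add_mem_filtration {k : ℤ} {x : σ → LaurentSeries ℂ} {m : ℕ} (l : ℕ)
    (h : (T ^ m) x ∈ filtration σ k) : (T ^ (l + m)) x ∈ filtration σ k := by
  induction l with
  | zero => rwa [zero_add]
  | succ l ih =>
    rw [add_right_comm, pow_succ']
    exact hT _ _ ih

theorem EventuallyIn.add {k : ℤ} {x y : σ → LaurentSeries ℂ} (hx : EventuallyIn T k x)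
    (hy : EventuallyIn T k y) : EventuallyIn T k (x + y) := by
  obtain ⟨m, hm⟩ := hx
  obtain ⟨l, hl⟩ := hy
  refine ⟨l + m, ?_⟩
  rw [map_add]
  exact add_mem (pow_add_mem_filtration hT l hm) (add_comm l m ▸ pow_add_mem_filtration hT m hl)

theorem EventuallyIn.map {k : ℤ} {x : σ → LaurentSeries ℂ} (hx : EventuallyIn T k x) :
    EventuallyIn T k (T x) := by
  obtain ⟨m, hm⟩ := hx
  refine ⟨m, ?_⟩
  change (T ^ m * T) x ∈ _
  rw [← pow_succ, add_comm]
  exact pow_add_mem_filtration hT 1 hm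

variable {τ : LaurentSeries ℂ → LaurentSeries ℂ}
  (hleib : ∀ (f : LaurentSeries ℂ) (x : σ → LaurentSeries ℂ), T (f • x) = f • T x + τ f • x)
  (hτ : ∀ (k : ℤ) (f : LaurentSeries ℂ),
    (∀ j < k, f.coeff j = 0) → ∀ j < k + 1, (τ f).coeff j = 0)
include hleib hτ

/-- The vectors on which `T` is topologically nilpotent are closed under multiplication by Laurent
series: downward induction on the order of the series, as `T` satisfies a Leibniz rule with a map
`τ` that raises the order. -/
theorem EventuallyIn.smul [Finite σ] {x : σ → LaurentSeries ℂ} (hx : ∀ l, EventuallyIn T l x)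
    (f : LaurentSeries ℂ) (k : ℤ) : EventuallyIn T k (f • x) := by
  obtain ⟨l, hl⟩ := exists_mem_filtration x
  have key : ∀ (n : ℕ) (f : LaurentSeries ℂ), (∀ j < k - l - n, f.coeff j = 0) →
      ∀ x ∈ filtration σ l, (∀ k, EventuallyIn T k x) → EventuallyIn T k (f • x) := by
    intro n
    induction n with
    | zero =>
      intro f hf x hxl _
      refine ⟨0, ?_⟩
      have := smul_mem_filtration hf hxl
      simpa using this
    | succ n ih =>
      intro f hf x hxl hx
      obtain ⟨m, hm⟩ := hx (n + 1 + l)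
      induction m generalizing x with
      | zero =>
        refine ⟨0, ?_⟩
        have := smul_mem_filtration hf hm
        rwa [show k - l - (n + 1 : ℕ) + (n + 1 + l) = k by push_cast; ring] at this
      | succ m ihm =>
        refine EventuallyIn.of_map ?_
        rw [hleib]
        refine EventuallyIn.add hT
          (ihm (T x) (hT _ _ hxl) (fun _ => (hx _).map hT) (by rwa [pow_succ] at hm)) ?_
        refine ih _ (fun j hj => hτ _ f hf j ?_) x hxl hx
        push_cast
        linarith
  obtain ⟨p, hp⟩ : ∃ p : ℤ, ∀ j < p, f.coeff j = 0 :=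
    ⟨f.order, fun j hj => HahnSeries.coeff_eq_zero_of_lt_order hj⟩
  refine key (k - l - p).toNat f (fun j hj => hp j ?_) x hl hx
  have := Int.self_le_toNat (k - l - p)
  omega

/-- The subspace of the vectors on which `T` is topologically nilpotent. -/
def nilSubmodule [Finite σ] : Submodule (LaurentSeries ℂ) (σ → LaurentSeries ℂ) where
  carrier := {x | ∀ k, EventuallyIn T k x}
  zero_mem' := fun _ => ⟨0, zero_mem _⟩
  add_mem' := fun hx hy k => (hx k).add hT (hy k)
  smul_mem' := fun f _ hx => EventuallyIn.smul hT hleib hτ hx f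

omit hT in
/-- Splitting lemma: if `T` acts on all graded pieces by the same endomorphism `N`, which is neither
invertible nor nilpotent, then the vectors on which `T` is topologically nilpotent form a proper
nonzero subspace. A kernel vector of `N` lifts by Fitting's lemma: the correction of order `k`
exists since the images of the high powers of `N` coincide. -/
theorem exists_stable_submodule [Finite σ] (hTN : ∀ (k : ℤ), ∀ x ∈ filtration σ k,
      T x ∈ filtration σ k ∧ coeffs k (T x) = N (coeffs k x))
    (hsing : ∃ u ≠ 0, N u = 0) (hnil : ¬ IsNilpotent N) :
    ∃ W : Submodule (LaurentSeries ℂ) (σ → LaurentSeries ℂ),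
      W ≠ ⊥ ∧ W ≠ ⊤ ∧ ∀ x ∈ W, T x ∈ W := by
  have hT : ∀ k : ℤ, ∀ x ∈ filtration σ k, T x ∈ filtration σ k := fun k x hx => (hTN k x hx).1
  refine ⟨nilSubmodule hT hleib hτ, ?_, ?_, fun x hx k => (hx k).map hT⟩
  · obtain ⟨u, hu, hu0⟩ := hsing
    obtain ⟨d, hd⟩ := Filter.eventually_atTop.mp N.eventually_iInf_range_pow_eq
    have hrange : ∀ m, ∀ y, ∃ z, (N ^ (d + m)) z = (N ^ d) y := by
      intro m y
      have : (N ^ d) y ∈ LinearMap.range (N ^ (d + m)) := by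
        rw [← hd (d + m) (Nat.le_add_right d m), hd d le_rfl]
        exact ⟨y, rfl⟩
      exact this
    -- `T` is applied `d + 1` times per step: the surplus `N ^ d` puts the obstruction in the
    -- stable image, where `N` is invertible
    obtain ⟨x, hx1, hx⟩ := exists_limit_of_step
      (fun k w => (T ^ ((d + 1) * k)) w ∈ filtration σ k)
      (monomialTuple_mem 0 u) (by
        have h := pow_mem_filtration hTN ((d + 1) * 1) (monomialTuple_mem 0 u)
        refine mem_filtration_succ h.1 ?_
        rw [h.2, coeffs_monomialTuple, mul_one, pow_succ]
        change (N ^ d) (N u) = 0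
        rw [hu0, map_zero]) (by
      intro k hk w hw hTw
      obtain ⟨y, hy⟩ := hrange ((d + 1) * k + 1) (-N (coeffs k ((T ^ ((d + 1) * k)) w)))
      have h1 := pow_mem_filtration hTN ((d + 1) * (k + 1)) (monomialTuple_mem k y)
      have h2 := pow_mem_filtration hTN (d + 1) hTw
      have h3 : (T ^ ((d + 1) * (k + 1))) w = (T ^ (d + 1)) ((T ^ ((d + 1) * k)) w) := by
        rw [mul_add, mul_one, add_comm, pow_add]
        rfl
      refine ⟨monomialTuple k y, monomialTuple_mem _ y, ?_⟩
      rw [Nat.cast_succ]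
      refine mem_filtration_succ ?_ ?_
      · rw [map_add, h3]
        exact add_mem h2.1 h1.1
      · rw [map_add, map_add, h3, h2.2, h1.2, coeffs_monomialTuple,
          show (d + 1) * (k + 1) = d + ((d + 1) * k + 1) by ring, hy, pow_succ, map_neg]
        exact add_neg_cancel _)
    intro hbot
    have hxW : x ∈ nilSubmodule hT hleib hτ := by
      intro k
      obtain ⟨w, -, hTw, hxw⟩ := hx (k.toNat + 1) (Nat.le_add_left 1 _)
      refine ⟨(d + 1) * (k.toNat + 1), ?_⟩
      have h := add_mem (pow_mem_filtration hTN ((d + 1) * (k.toNat + 1)) hxw).1 hTw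
      rw [map_sub, sub_add_cancel] at h
      refine filtration_anti ?_ h
      have := Int.self_le_toNat k
      push_cast
      omega
    rw [hbot, Submodule.mem_bot] at hxW
    subst hxW
    have := coeffs_eq_zero (k := 0) (by simpa using hx1)
    rw [coeffs_monomialTuple] at this
    exact hu this
  · intro htop
    refine hnil (Module.End.isNilpotent_iff_of_finite.mpr fun u => ?_)
    obtain ⟨m, hm⟩ : EventuallyIn T 1 (monomialTuple 0 u) :=
      (htop ▸ Submodule.mem_top : monomialTuple 0 u ∈ nilSubmodule hT hleib hτ) 1
    refine ⟨m, ?_⟩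
    have h := (pow_mem_filtration hTN m (monomialTuple_mem 0 u)).2
    rw [coeffs_monomialTuple] at h
    rw [← h]
    exact coeffs_eq_zero (by simpa using hm)

end Operators

/-! ### Systems of differential equations over Laurent series -/

section System

variable {σ : Type*} [Fintype σ]

/-- The operator `x ↦ g d_b(x) + A x` on tuples of Laurent series in `s = t^{1/b}`. -/
def systemOp (b : ℕ+) (g : LaurentSeries ℂ) (A : Matrix σ σ (LaurentSeries ℂ)) :
    AddMonoid.End (σ → LaurentSeries ℂ) :=
  AddMonoidHom.mk' (fun x i => g * eulerRoot b (x i) + ∑ j, A i j * x j) (fun x y => by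
    ext1 i
    simp only [Pi.add_apply, map_add, mul_add, Finset.sum_add_distrib]
    abel)

theorem systemOp_apply (b : ℕ+) (g : LaurentSeries ℂ) (A : Matrix σ σ (LaurentSeries ℂ))
    (x : σ → LaurentSeries ℂ) (i : σ) :
    systemOp b g A x i = g * eulerRoot b (x i) + ∑ j, A i j * x j :=
  rfl

theorem systemOp_smul (b : ℕ+) (g : LaurentSeries ℂ) (A : Matrix σ σ (LaurentSeries ℂ))
    (f : LaurentSeries ℂ) (x : σ → LaurentSeries ℂ) :
    systemOp b g A (f • x) = f • systemOp b g A x + (g * eulerRoot b f) • x := by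
  ext1 i
  simp only [systemOp_apply, Pi.add_apply, Pi.smul_apply, smul_eq_mul, eulerRoot_mul, mul_add,
    Finset.mul_sum]
  simp only [mul_left_comm f, mul_comm (x i)]
  ring

variable [DecidableEq σ]

theorem systemOp_sub_scalar (b : ℕ+) (g : LaurentSeries ℂ) (A : Matrix σ σ (LaurentSeries ℂ))
    (c : LaurentSeries ℂ) (x : σ → LaurentSeries ℂ) :
    systemOp b g (A - Matrix.scalar σ c) x = systemOp b g A x - c • x := by
  ext1 i
  simp only [systemOp_apply, Pi.sub_apply, Pi.smul_apply, smul_eq_mul, Matrix.sub_apply, sub_mul,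
    Finset.sum_sub_distrib, Matrix.scalar_apply, Matrix.diagonal_apply, ite_mul, zero_mul,
    Finset.sum_ite_eq, Finset.mem_univ, if_true]
  ring

theorem coeff_eulerRoot_eq_zero_of_lt (b : ℕ+) {k : ℤ} {f : LaurentSeries ℂ}
    (hf : ∀ j < k, f.coeff j = 0) : ∀ j < k, (eulerRoot b f).coeff j = 0 := fun j hj => by
  rw [coeff_eulerRoot, hf j hj, mul_zero, mul_zero]

/-- The matrix of constant coefficients. -/
def residueMatrix (A : Matrix σ σ (LaurentSeries ℂ)) : Matrix σ σ ℂ :=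
  A.map fun f => f.coeff 0

theorem systemOp_mem_filtration (b : ℕ+) {g : LaurentSeries ℂ}
    {A : Matrix σ σ (LaurentSeries ℂ)} (hg : ∀ j < 0, g.coeff j = 0)
    (hA : ∀ i j, ∀ m < 0, (A i j).coeff m = 0) (k : ℤ) (x : σ → LaurentSeries ℂ)
    (hx : x ∈ filtration σ k) :
    systemOp b g A x ∈ filtration σ k ∧ coeffs k (systemOp b g A x) =
      (Matrix.toLin' (residueMatrix A) + (g.coeff 0 * ((b : ℂ)⁻¹ * k)) • 1) (coeffs k x) := by
  constructor
  · intro i j hj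
    rw [← zero_add k] at hj
    rw [systemOp_apply, HahnSeries.coeff_add,
      coeff_mul_eq_zero_of_lt hg (coeff_eulerRoot_eq_zero_of_lt b (hx i)) hj, zero_add,
      HahnSeries.coeff_sum]
    exact Finset.sum_eq_zero fun l _ => coeff_mul_eq_zero_of_lt (hA i l) (hx l) hj
  · ext i
    have h0 : ∀ f h : LaurentSeries ℂ, (∀ j < 0, f.coeff j = 0) → (∀ j < k, h.coeff j = 0) →
        (f * h).coeff k = f.coeff 0 * h.coeff k := fun f h hf hh => by
      simpa using coeff_mul_add hf hh
    rw [coeffs_apply, systemOp_apply, HahnSeries.coeff_add,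
      h0 _ _ hg (coeff_eulerRoot_eq_zero_of_lt b (hx i)), HahnSeries.coeff_sum, coeff_eulerRoot,
      Finset.sum_congr rfl fun l _ => h0 _ _ (hA i l) (hx l)]
    simp only [LinearMap.add_apply, Matrix.toLin'_apply, LinearMap.smul_apply, Module.End.one_apply,
      Pi.add_apply, Pi.smul_apply, smul_eq_mul, Matrix.mulVec, dotProduct, coeffs_apply,
      residueMatrix, Matrix.map_apply]
    ring

theorem coeff_sub_scalar_C (A : Matrix σ σ (LaurentSeries ℂ)) (c : ℂ)
    (hA : ∀ i j, ∀ m < 0, (A i j).coeff m = 0) (i j : σ) (m : ℤ) (hm : m < 0) :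
    ((A - Matrix.scalar σ (HahnSeries.C c : LaurentSeries ℂ)) i j).coeff m = 0 := by
  rw [Matrix.sub_apply, HahnSeries.coeff_sub, hA i j m hm, Matrix.scalar_apply,
    Matrix.diagonal_apply]
  split_ifs
  · rw [HahnSeries.C_apply, HahnSeries.coeff_single_of_ne hm.ne, sub_zero]
  · exact sub_zero _

theorem toLin'_residueMatrix_sub_scalar_C (A : Matrix σ σ (LaurentSeries ℂ)) (c : ℂ) :
    Matrix.toLin' (residueMatrix (A - Matrix.scalar σ (HahnSeries.C c : LaurentSeries ℂ))) =
      Matrix.toLin' (residueMatrix A) - c • 1 := by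
  have : residueMatrix (A - Matrix.scalar σ (HahnSeries.C c : LaurentSeries ℂ)) =
      residueMatrix A - c • 1 := by
    ext i j
    simp only [residueMatrix, Matrix.map_apply, Matrix.sub_apply, HahnSeries.coeff_sub,
      Matrix.scalar_apply, Matrix.diagonal_apply, Matrix.smul_apply, Matrix.one_apply]
    split_ifs <;> simp [HahnSeries.C_apply]
  rw [this, map_sub, map_smul, Matrix.toLin'_one]
  rfl

/-- A system without pole has an eigenvector with constant eigenvalue. The eigenvalue `c` of the
residue matrix is chosen with minimal real part, so that no `c - k / b` with `k ≥ 1` is another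
one. -/
theorem exists_eigenvector_of_integral [Nonempty σ] (b : ℕ+) {A : Matrix σ σ (LaurentSeries ℂ)}
    (hA : ∀ i j, ∀ m < 0, (A i j).coeff m = 0) :
    ∃ (c : ℂ) (x : σ → LaurentSeries ℂ), x ≠ 0 ∧
      systemOp b 1 A x = (HahnSeries.C c : LaurentSeries ℂ) • x := by
  let N := Matrix.toLin' (residueMatrix A)
  obtain ⟨c, hc, hmin⟩ := Set.exists_min_image {c | Module.End.HasEigenvalue N c} Complex.re
    (Module.End.finite_hasEigenvalue N) (Module.End.exists_eigenvalue N)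
  obtain ⟨u, hu⟩ := hc.exists_hasEigenvector
  have h1 : ∀ j < 0, (1 : LaurentSeries ℂ).coeff j = 0 := fun j hj => by
    rw [HahnSeries.coeff_one, if_neg hj.ne]
  have hone : (1 : LaurentSeries ℂ).coeff 0 = 1 := by simp
  obtain ⟨x, hx0, hx⟩ := exists_ne_zero_map_eq_zero
    (T := systemOp b 1 (A - Matrix.scalar σ (HahnSeries.C c : LaurentSeries ℂ)))
    (fun k => N - (c - (b : ℂ)⁻¹ * k) • 1) (fun k x hx => by
      have h := systemOp_mem_filtration b h1 (coeff_sub_scalar_C A c hA) k x hx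
      refine ⟨h.1, h.2.trans ?_⟩
      rw [toLin'_residueMatrix_sub_scalar_C, hone]
      congr 1
      push_cast
      rw [one_mul]
      module) ⟨u, hu.2, by
        simpa [sub_eq_zero] using hu.apply_eq_smul⟩ (fun k hk => by
      rw [← LinearMap.injective_iff_surjective, ← LinearMap.ker_eq_bot]
      by_contra hker
      have hev : Module.End.HasEigenvalue N (c - (b : ℂ)⁻¹ * k) := by
        rw [Module.End.hasEigenvalue_iff, Module.End.eigenspace_def]
        exact hker
      have h := hmin _ hev
      have hb : (0 : ℝ) < (b : ℝ)⁻¹ * k := by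
        have : (0 : ℝ) < b := by exact_mod_cast b.pos
        have : (0 : ℝ) < k := by exact_mod_cast hk
        positivity
      have hre : (c - (b : ℂ)⁻¹ * k).re = c.re - (b : ℝ)⁻¹ * k := by
        rw [Complex.sub_re]
        congr 1
        rw [← Complex.ofReal_re ((b : ℝ)⁻¹ * k)]
        push_cast
        rfl
      rw [hre] at h
      linarith)
  refine ⟨c, x, hx0, ?_⟩
  rw [systemOp_sub_scalar, sub_eq_zero] at hx
  exact hx

/-- If `g` has positive order and the residue matrix is not nilpotent but has trace zero, then its
eigenvalues are not all equal, and the system splits. -/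
theorem exists_stable_submodule_of_trace_eq_zero [Nonempty σ] (b : ℕ+) {g : LaurentSeries ℂ}
    {A : Matrix σ σ (LaurentSeries ℂ)} (hg : ∀ j < 1, g.coeff j = 0)
    (hA : ∀ i j, ∀ m < 0, (A i j).coeff m = 0) (htr : (residueMatrix A).trace = 0)
    (hnil : ¬ IsNilpotent (residueMatrix A)) :
    ∃ W : Submodule (LaurentSeries ℂ) (σ → LaurentSeries ℂ),
      W ≠ ⊥ ∧ W ≠ ⊤ ∧ ∀ x ∈ W, systemOp b g A x ∈ W := by
  let N := Matrix.toLin' (residueMatrix A)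
  obtain ⟨c, hc⟩ := Module.End.exists_eigenvalue N
  obtain ⟨u, hu⟩ := hc.exists_hasEigenvector
  obtain ⟨W, hbot, htop, hW⟩ := exists_stable_submodule
    (T := systemOp b g (A - Matrix.scalar σ (HahnSeries.C c : LaurentSeries ℂ))) (N := N - c • 1)
    (systemOp_smul b g _) (fun k f hf j hj => by
      rw [add_comm] at hj
      exact coeff_mul_eq_zero_of_lt hg (coeff_eulerRoot_eq_zero_of_lt b hf) hj)
    (fun k x hx => by
      have h := systemOp_mem_filtration b (fun j hj => hg j (hj.trans zero_lt_one))
        (coeff_sub_scalar_C A c hA) k x hx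
      rw [toLin'_residueMatrix_sub_scalar_C, hg 0 zero_lt_one, zero_mul, zero_smul, add_zero] at h
      exact h) ⟨u, hu.2, by simpa [sub_eq_zero] using hu.apply_eq_smul⟩ (fun hn => by
      have h := (LinearMap.isNilpotent_trace_of_isNilpotent hn).eq_zero
      have hNtr : LinearMap.trace ℂ (σ → ℂ) N = 0 := by
        rw [← htr]
        exact Matrix.trace_toLin'_eq _
      rw [map_sub, hNtr, map_smul, LinearMap.trace_one, zero_sub, neg_eq_zero, smul_eq_mul,
        mul_eq_zero] at h
      have hc0 : c = 0 := h.resolve_right (by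
        rw [Module.finrank_fintype_fun_eq_card]
        exact_mod_cast Fintype.card_ne_zero)
      rw [hc0, zero_smul, sub_zero] at hn
      exact hnil (Matrix.isNilpotent_toLin'_iff _ |>.mp hn))
  refine ⟨W, hbot, htop, fun x hx => ?_⟩
  have h := hW x hx
  rw [systemOp_sub_scalar] at h
  exact (Submodule.sub_mem_iff_left W (W.smul_mem _ hx)).mp h

end System

/-! ### The differential field of Puiseux series -/

/-- The embedding `ℂ((t^{1/b})) → ℂ((t^ℚ))` into Hahn series. -/
def puiseuxHom (b : ℕ+) : LaurentSeries ℂ →+* HahnSeries ℚ ℂ :=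
  HahnSeries.embDomainRingHom
    ((AddMonoidHom.mulLeft ((b : ℚ)⁻¹)).comp (Int.castAddHom ℚ))
    (fun _ _ h => Int.cast_injective
      (mul_left_cancel₀ (inv_ne_zero (by exact_mod_cast b.ne_zero)) h))
    (fun _ _ => (mul_le_mul_iff_right₀ (inv_pos.mpr (by exact_mod_cast b.pos))).trans Int.cast_le)

theorem coeff_puiseuxHom (b : ℕ+) (f : LaurentSeries ℂ) (n : ℤ) :
    (puiseuxHom b f).coeff ((b : ℚ)⁻¹ * n) = f.coeff n :=
  HahnSeries.embDomain_mk_coeff _ _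

theorem coeff_puiseuxHom_of_ne (b : ℕ+) (f : LaurentSeries ℂ) {q : ℚ}
    (hq : ∀ n : ℤ, (b : ℚ)⁻¹ * n ≠ q) : (puiseuxHom b f).coeff q = 0 :=
  HahnSeries.embDomain_of_notMem_range (by
    rintro ⟨n, hn⟩
    exact hq n hn)

theorem puiseuxHom_single (b : ℕ+) (n : ℤ) (c : ℂ) :
    puiseuxHom b (HahnSeries.single n c) = HahnSeries.single ((b : ℚ)⁻¹ * n) c :=
  HahnSeries.embDomain_single

theorem coeff_inclusion (b : ℕ+) (f : LaurentSeries ℂ) (n : ℤ) :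
    (inclusion b f).coeff ((b : ℤ) * n) = f.coeff n :=
  HahnSeries.embDomain_mk_coeff _ _

theorem coeff_inclusion_of_ne (b : ℕ+) (f : LaurentSeries ℂ) {n : ℤ}
    (hn : ∀ m : ℤ, (b : ℤ) * m ≠ n) : (inclusion b f).coeff n = 0 :=
  HahnSeries.embDomain_of_notMem_range (by
    rintro ⟨m, hm⟩
    exact hn m hm)

theorem puiseuxHom_mul_inclusion (b c : ℕ+) (f : LaurentSeries ℂ) :
    puiseuxHom (b * c) (inclusion c f) = puiseuxHom b f := by
  have hb : (b : ℚ) ≠ 0 := by exact_mod_cast b.ne_zero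
  have hc : (c : ℚ) ≠ 0 := by exact_mod_cast c.ne_zero
  have hmul : ∀ n : ℤ, ((b * c : ℕ+) : ℚ)⁻¹ * ((c * n : ℤ) : ℚ) = (b : ℚ)⁻¹ * n := fun n => by
    push_cast
    field_simp
  ext q
  by_cases hq : ∃ n : ℤ, (b : ℚ)⁻¹ * n = q
  · obtain ⟨n, rfl⟩ := hq
    rw [coeff_puiseuxHom, ← hmul, coeff_puiseuxHom, coeff_inclusion]
  · push Not at hq
    rw [coeff_puiseuxHom_of_ne b f hq]
    by_cases hq' : ∃ n : ℤ, ((b * c : ℕ+) : ℚ)⁻¹ * n = q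
    · obtain ⟨n, rfl⟩ := hq'
      rw [coeff_puiseuxHom]
      refine coeff_inclusion_of_ne c f fun m hm => hq m ?_
      rw [← hmul, hm]
    · push Not at hq'
      exact coeff_puiseuxHom_of_ne _ _ hq'

/-- The field of Puiseux series: the union of the images of the fields `ℂ((t^{1/b}))` in the field
of Hahn series with rational exponents. -/
def Puiseux : Subfield (HahnSeries ℚ ℂ) := ⨆ b, (puiseuxHom b).fieldRange

theorem fieldRange_puiseuxHom_le (b c : ℕ+) :
    (puiseuxHom b).fieldRange ≤ (puiseuxHom (b * c)).fieldRange := by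
  rintro _ ⟨f, rfl⟩
  exact ⟨inclusion c f, puiseuxHom_mul_inclusion b c f⟩

theorem mem_puiseux {x : HahnSeries ℚ ℂ} : x ∈ Puiseux ↔ ∃ b f, puiseuxHom b f = x := by
  rw [Puiseux, Subfield.mem_iSup_of_directed]
  · rfl
  · intro b c
    exact ⟨b * c, fieldRange_puiseuxHom_le b c, mul_comm b c ▸ fieldRange_puiseuxHom_le c b⟩

/-- The embedding of `ℂ((t^{1/b}))` into the field of Puiseux series. -/
def toPuiseux (b : ℕ+) : LaurentSeries ℂ →+* Puiseux :=
  (puiseuxHom b).codRestrict Puiseux fun f => mem_puiseux.mpr ⟨b, f, rfl⟩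

theorem coe_toPuiseux (b : ℕ+) (f : LaurentSeries ℂ) :
    (toPuiseux b f : HahnSeries ℚ ℂ) = puiseuxHom b f :=
  rfl

instance : CharZero Puiseux :=
  charZero_of_injective_ringHom
    (((toPuiseux 1).comp (HahnSeries.C : ℂ →+* LaurentSeries ℂ)).injective)

/-- Finitely many Puiseux series have a common denominator of exponents. -/
theorem exists_common_denominator {α : Type*} [Finite α] (x : α → Puiseux) :
    ∃ (b : ℕ+) (f : α → LaurentSeries ℂ), ∀ i, toPuiseux b (f i) = x i := by
  choose d g hg using fun i => mem_puiseux.mp (x i).2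
  have := Fintype.ofFinite α
  have hdvd : ∀ i, ∃ c, ∏ j, d j = d i * c := fun i => by
    classical exact ⟨_, (Finset.mul_prod_erase _ d (Finset.mem_univ i)).symm⟩
  choose c hc using hdvd
  refine ⟨∏ j, d j, fun i => inclusion (c i) (g i), fun i => Subtype.ext ?_⟩
  rw [coe_toPuiseux, hc i, puiseuxHom_mul_inclusion, hg]

/-- The map `t d/dt` on Hahn series with rational exponents. -/
def hahnEuler : HahnSeries ℚ ℂ →+ HahnSeries ℚ ℂ where
  toFun f := ⟨fun q => (q : ℂ) * f.coeff q,
    f.isPWO_support.mono fun _ hq => right_ne_zero_of_mul hq⟩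
  map_zero' := by
    ext q
    simp
  map_add' f g := by
    ext q
    simp [mul_add]

theorem coeff_hahnEuler (f : HahnSeries ℚ ℂ) (q : ℚ) :
    (hahnEuler f).coeff q = (q : ℂ) * f.coeff q :=
  rfl

theorem hahnEuler_mul (f g : HahnSeries ℚ ℂ) :
    hahnEuler (f * g) = f * hahnEuler g + g * hahnEuler f := by
  have hsupp : ∀ h : HahnSeries ℚ ℂ, (hahnEuler h).support ⊆ h.support :=
    fun h i hi => right_ne_zero_of_mul hi
  rw [mul_comm g]
  ext n
  rw [coeff_hahnEuler, HahnSeries.coeff_add, HahnSeries.coeff_mul,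
    HahnSeries.coeff_mul_right' g.isPWO_support (hsupp g),
    HahnSeries.coeff_mul_left' f.isPWO_support (hsupp f), Finset.mul_sum,
    ← Finset.sum_add_distrib]
  refine Finset.sum_congr rfl fun ij hij => ?_
  obtain ⟨-, -, rfl⟩ := Finset.mem_antidiagonal.mp hij
  rw [coeff_hahnEuler, coeff_hahnEuler]
  push_cast
  ring

theorem hahnEuler_puiseuxHom (b : ℕ+) (f : LaurentSeries ℂ) :
    hahnEuler (puiseuxHom b f) = puiseuxHom b (eulerRoot b f) := by
  ext q
  rw [coeff_hahnEuler]
  by_cases hq : ∃ n : ℤ, (b : ℚ)⁻¹ * n = q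
  · obtain ⟨n, rfl⟩ := hq
    rw [coeff_puiseuxHom, coeff_puiseuxHom, coeff_eulerRoot]
    push_cast
    ring
  · push Not at hq
    rw [coeff_puiseuxHom_of_ne b _ hq, coeff_puiseuxHom_of_ne b _ hq, mul_zero]

/-- The map `t d/dt` on Puiseux series. -/
def puiseuxEuler : Puiseux →+ Puiseux :=
  (hahnEuler.comp Puiseux.subtype.toAddMonoidHom).codRestrict Puiseux fun x => by
    obtain ⟨b, f, hf⟩ := mem_puiseux.mp x.2
    refine mem_puiseux.mpr ⟨b, eulerRoot b f, ?_⟩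
    rw [← hahnEuler_puiseuxHom, hf]
    rfl

instance : Differential Puiseux :=
  differentialOfLeibniz puiseuxEuler fun f g => Subtype.ext (hahnEuler_mul f g)

theorem coe_deriv (x : Puiseux) :
    ((Differential.deriv x : Puiseux) : HahnSeries ℚ ℂ) = hahnEuler x :=
  rfl

theorem deriv_toPuiseux (b : ℕ+) (f : LaurentSeries ℂ) :
    Differential.deriv (toPuiseux b f) = toPuiseux b (eulerRoot b f) :=
  Subtype.ext (hahnEuler_puiseuxHom b f)

theorem coeff_toPuiseux (b : ℕ+) (f : LaurentSeries ℂ) (n : ℤ) :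
    (toPuiseux b f : HahnSeries ℚ ℂ).coeff ((b : ℚ)⁻¹ * n) = f.coeff n :=
  coeff_puiseuxHom b f n

/-- The Puiseux series `t^q`. -/
def tPow (q : ℚ) : Puiseux :=
  ⟨HahnSeries.single q 1, mem_puiseux.mpr ⟨q.pnatDen, HahnSeries.single q.num 1, by
    rw [puiseuxHom_single, Rat.coe_pnatDen, inv_mul_eq_div, Rat.num_div_den]⟩⟩

theorem coe_tPow (q : ℚ) : (tPow q : HahnSeries ℚ ℂ) = HahnSeries.single q 1 :=
  rfl

theorem tPow_zero : tPow 0 = 1 :=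
  rfl

theorem tPow_mul (p q : ℚ) : tPow p * tPow q = tPow (p + q) := by
  refine Subtype.ext ?_
  rw [Subfield.coe_mul, coe_tPow, coe_tPow, coe_tPow, HahnSeries.single_mul_single, mul_one]

theorem tPow_ne_zero (q : ℚ) : tPow q ≠ 0 := fun h => by
  have := tPow_mul q (-q)
  rw [h, zero_mul, add_neg_cancel, tPow_zero] at this
  exact zero_ne_one this

theorem coe_ratCast (q : ℚ) : (((q : ℚ) : Puiseux) : HahnSeries ℚ ℂ) = HahnSeries.C (q : ℂ) := by
  rw [map_ratCast]
  rfl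

theorem deriv_tPow (q : ℚ) : Differential.deriv (tPow q) = (q : Puiseux) * tPow q := by
  refine Subtype.ext ?_
  rw [coe_deriv, Subfield.coe_mul, coe_ratCast]
  ext p
  rw [coeff_hahnEuler, HahnSeries.C_apply, HahnSeries.coeff_single_zero_mul, coe_tPow]
  by_cases h : p = q
  · rw [h]
  · rw [HahnSeries.coeff_single_of_ne h, mul_zero, mul_zero]

theorem coeff_tPow_mul (q : ℚ) (x : Puiseux) (p : ℚ) :
    ((tPow q * x : Puiseux) : HahnSeries ℚ ℂ).coeff p = (x : HahnSeries ℚ ℂ).coeff (p - q) := by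
  rw [Subfield.coe_mul, coe_tPow, HahnSeries.coeff_single_mul, one_mul]

namespace DifferentialOperator

/-! ### Cyclic vectors -/

section Cyclic

variable {F : Type*} [Field F] [Differential F] {V : Type*} [AddCommGroup V] [Module F V]

theorem map_smul_eq (D : DifferentialOperator F V) (a : F) (v : V) :
    D (a • v) = a • D v + Differential.deriv a • v :=
  D.leibniz a v

/-- The operator `D - f`. -/
def twist (D : DifferentialOperator F V) (f : F) : DifferentialOperator F V where
  toAddMonoidHom := D.toAddMonoidHom - DistribSMul.toAddMonoidHom V f
  leibniz a v := by
    change D (a • v) - f • a • v = a • (D v - f • v) + Differential.deriv a • v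
    rw [map_smul_eq, smul_sub, smul_comm f a]
    abel

theorem twist_apply (D : DifferentialOperator F V) (f : F) (v : V) :
    D.twist f v = D v - f • v :=
  rfl

/-- The vector `Dⁱ v`. -/
def iter (D : DifferentialOperator F V) (v : V) (i : ℕ) : V :=
  D.toAddMonoidHom^[i] v

@[simp]
theorem iter_zero (D : DifferentialOperator F V) (v : V) : D.iter v 0 = v :=
  rfl

theorem iter_succ (D : DifferentialOperator F V) (v : V) (i : ℕ) :
    D.iter v (i + 1) = D (D.iter v i) :=
  Function.iterate_succ_apply' _ _ _

/-- The span of `v, D v, …, Dᵏ⁻¹ v`. -/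
def krylov (D : DifferentialOperator F V) (v : V) (k : ℕ) : Submodule F V :=
  Submodule.span F (Set.range fun i : Fin k => D.iter v i)

theorem iter_mem_krylov (D : DifferentialOperator F V) (v : V) {i k : ℕ} (h : i < k) :
    D.iter v i ∈ D.krylov v k :=
  Submodule.subset_span ⟨⟨i, h⟩, rfl⟩

theorem krylov_le_iff {D : DifferentialOperator F V} {v : V} {k : ℕ} {W : Submodule F V} :
    D.krylov v k ≤ W ↔ ∀ i < k, D.iter v i ∈ W := by
  rw [krylov, Submodule.span_le, Set.range_subset_iff]
  exact ⟨fun h i hi => h ⟨i, hi⟩, fun h i => h i i.2⟩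

theorem krylov_mono (D : DifferentialOperator F V) (v : V) {k l : ℕ} (h : k ≤ l) :
    D.krylov v k ≤ D.krylov v l :=
  krylov_le_iff.mpr fun _ hi => D.iter_mem_krylov v (hi.trans_le h)

/-- A subspace that contains the images of generators of `W` and `W` itself contains the image of
`W`. -/
theorem map_mem_of_mem_span (D : DifferentialOperator F V) {s : Set V} {W : Submodule F V}
    (hs : ∀ x ∈ s, x ∈ W ∧ D x ∈ W) {x : V} (hx : x ∈ Submodule.span F s) : D x ∈ W := by
  have h : x ∈ W ∧ D x ∈ W := by
    induction hx using Submodule.span_induction with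
    | mem x hx => exact hs x hx
    | zero => exact ⟨W.zero_mem, by rw [map_zero]; exact W.zero_mem⟩
    | add x y _ _ hx hy => exact ⟨W.add_mem hx.1 hy.1, by rw [map_add]; exact W.add_mem hx.2 hy.2⟩
    | smul a x _ hx =>
      refine ⟨W.smul_mem a hx.1, ?_⟩
      rw [map_smul_eq]
      exact W.add_mem (W.smul_mem _ hx.2) (W.smul_mem _ hx.1)
  exact h.2

theorem map_mem_krylov (D : DifferentialOperator F V) (v : V) {k : ℕ} {x : V}
    (hx : x ∈ D.krylov v k) : D x ∈ D.krylov v (k + 1) := by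
  refine D.map_mem_of_mem_span ?_ hx
  rintro _ ⟨i, rfl⟩
  exact ⟨D.iter_mem_krylov v (by omega), D.iter_succ v i ▸ D.iter_mem_krylov v (by omega)⟩

theorem linearIndependent_iter (D : DifferentialOperator F V) (v : V) (k : ℕ)
    (h : ∀ j < k, D.iter v j ∉ D.krylov v j) :
    LinearIndependent F (fun i : Fin k => D.iter v i) := by
  induction k with
  | zero => exact linearIndependent_empty_type
  | succ k ih =>
    rw [linearIndependent_finSucc']
    exact ⟨ih fun j hj => h j (hj.trans (Nat.lt_succ_self k)), h k (Nat.lt_succ_self k)⟩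

/-- `D` has no invariant subspaces but the trivial ones. -/
def IsIrreducible (D : DifferentialOperator F V) : Prop :=
  ∀ W : Submodule F V, (∀ x ∈ W, D x ∈ W) → W = ⊥ ∨ W = ⊤

theorem IsIrreducible.twist {D : DifferentialOperator F V} (hD : D.IsIrreducible) (f : F) :
    (D.twist f).IsIrreducible := fun W hW => hD W fun x hx =>
  (W.sub_mem_iff_left (W.smul_mem f hx)).mp (hW x hx)

theorem IsIrreducible.exists_basis [FiniteDimensional F V] {D : DifferentialOperator F V}
    (hD : D.IsIrreducible) {v : V} (hv : v ≠ 0) {n : ℕ} (hn : Module.finrank F V = n) :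
    ∃ e : Module.Basis (Fin n) F V, ∀ i, e i = D.iter v i := by
  classical
  have hex : ∃ m, D.iter v m ∈ D.krylov v m := by
    by_contra! h
    have := (D.linearIndependent_iter v (Module.finrank F V + 1)
      fun j _ => h j).fintype_card_le_finrank
    rw [Fintype.card_fin] at this
    omega
  obtain ⟨m, hm, hmin⟩ : ∃ m, D.iter v m ∈ D.krylov v m ∧
      ∀ j < m, D.iter v j ∉ D.krylov v j :=
    ⟨Nat.find hex, Nat.find_spec hex, fun _ hj => Nat.find_min hex hj⟩
  have hm0 : 0 < m := by
    rcases Nat.eq_zero_or_pos m with rfl | h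
    · exact absurd (by simpa [krylov] using hm) hv
    · exact h
  have htop : D.krylov v m = ⊤ := by
    refine (hD _ fun x hx => ?_).resolve_left fun h => hv ?_
    · refine D.map_mem_of_mem_span ?_ hx
      rintro _ ⟨i, rfl⟩
      refine ⟨D.iter_mem_krylov v i.2, ?_⟩
      rw [← iter_succ]
      rcases (Nat.succ_le_iff.mpr i.2).lt_or_eq with hi | hi
      · exact D.iter_mem_krylov v hi
      · rwa [← Nat.succ_eq_add_one, hi]
    · rw [← Submodule.mem_bot F, ← h]
      exact D.iter_mem_krylov v hm0
  let e := Module.Basis.mk (D.linearIndependent_iter v m hmin) htop.ge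
  obtain rfl : n = m := by
    rw [← hn, Module.finrank_eq_card_basis e, Fintype.card_fin]
  exact ⟨e, fun i => Module.Basis.mk_apply _ _ i⟩

theorem iter_twist_mem_krylov (D : DifferentialOperator F V) (v : V) (f : F) (k : ℕ) :
    (D.twist f).iter v k ∈ D.krylov v (k + 1) := by
  induction k with
  | zero => exact D.iter_mem_krylov v Nat.zero_lt_one
  | succ k ih =>
    rw [iter_succ, twist_apply]
    exact sub_mem (D.map_mem_krylov v ih)
      (Submodule.smul_mem _ _ (D.krylov_mono v (Nat.le_succ _) ih))

theorem krylov_twist_le (D : DifferentialOperator F V) (v : V) (f : F) (k : ℕ) :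
    (D.twist f).krylov v k ≤ D.krylov v k :=
  krylov_le_iff.mpr fun i hi => D.krylov_mono v hi (D.iter_twist_mem_krylov v f i)

theorem twist_twist_neg (D : DifferentialOperator F V) (f : F) : (D.twist f).twist (-f) = D := by
  cases D
  simp only [twist]
  congr 1
  ext v
  simp

theorem krylov_twist (D : DifferentialOperator F V) (v : V) (f : F) (k : ℕ) :
    (D.twist f).krylov v k = D.krylov v k :=
  le_antisymm (D.krylov_twist_le v f k)
    (by simpa only [twist_twist_neg] using (D.twist f).krylov_twist_le v (-f) k)

/-- The first two terms of the expansion of `(D - f)ᵏ⁺¹`. -/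
theorem iter_twist_succ_sub_mem (D : DifferentialOperator F V) (v : V) (f : F) (k : ℕ) :
    (D.twist f).iter v (k + 1) - D.iter v (k + 1) + ((k + 1 : F) * f) • D.iter v k ∈
      D.krylov v k := by
  induction k with
  | zero =>
    simp [iter_succ, twist_apply]
  | succ k ih =>
    set g : F := (k + 1 : F) * f with hg
    set w := (D.twist f).iter v (k + 1) - D.iter v (k + 1) + g • D.iter v k with hw
    have hit : (D.twist f).iter v (k + 1) = D.iter v (k + 1) - g • D.iter v k + w := by
      rw [hw]
      abel
    have hgf : ((k + 1 : ℕ) + 1 : F) * f = g + f := by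
      rw [hg]
      push_cast
      ring
    have hexp : (D.twist f).iter v (k + 1 + 1) - D.iter v (k + 1 + 1) +
        (((k + 1 : ℕ) + 1 : F) * f) • D.iter v (k + 1) =
        D w - f • w + (f * g - Differential.deriv g) • D.iter v k := by
      rw [iter_succ (D.twist f), twist_apply, hit, map_add, map_sub, map_smul_eq,
        ← iter_succ, ← iter_succ, hgf]
      module
    rw [hexp]
    exact add_mem (sub_mem (D.map_mem_krylov v ih)
      (Submodule.smul_mem _ _ (D.krylov_mono v (Nat.le_succ k) ih)))
      (Submodule.smul_mem _ _ (D.iter_mem_krylov v (Nat.lt_succ_self k)))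

/-- A Tschirnhaus transformation: for suitable `f`, the term of index `n` in the relation for
`(D - f)ⁿ⁺¹ v` vanishes. -/
theorem exists_iter_twist_mem_krylov [CharZero F] (D : DifferentialOperator F V) (v : V) {n : ℕ}
    (h : D.iter v (n + 1) ∈ D.krylov v (n + 1)) :
    ∃ f, (D.twist f).iter v (n + 1) ∈ (D.twist f).krylov v n := by
  have hsup : D.krylov v (n + 1) ≤ D.krylov v n ⊔ Submodule.span F {D.iter v n} := by
    rw [krylov_le_iff]
    intro i hi
    rcases (Nat.lt_succ_iff.mp hi).lt_or_eq with hi | rfl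
    · exact Submodule.mem_sup_left (D.iter_mem_krylov v hi)
    · exact Submodule.mem_sup_right (Submodule.mem_span_singleton_self _)
  obtain ⟨w, hw, y, hy, hwy⟩ := Submodule.mem_sup.mp (hsup h)
  obtain ⟨a, rfl⟩ := Submodule.mem_span_singleton.mp hy
  have hn : (n + 1 : F) ≠ 0 := by exact_mod_cast n.succ_ne_zero
  refine ⟨a / (n + 1), ?_⟩
  have hkey := D.iter_twist_succ_sub_mem v (a / (n + 1)) n
  rw [mul_div_cancel₀ _ hn, ← hwy] at hkey
  rw [krylov_twist]
  have h2 := add_mem hkey hw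
  rwa [show ∀ x : V, x - (w + a • D.iter v n) + a • D.iter v n + w = x from fun x => by abel]
    at h2

end Cyclic

/-! ### Operators over the field of Puiseux series -/

section Lattice

variable {V : Type*} [AddCommGroup V] [Module Puiseux V] {σ : Type*} [Fintype σ]

/-- The linear combinations of a basis `e` with coefficients in `ℂ((t^{1/b}))`, as a map that is
semilinear along the embedding of this field into the Puiseux series. -/
def combination (e : Module.Basis σ Puiseux V) (b : ℕ+) :
    (σ → LaurentSeries ℂ) →ₛₗ[toPuiseux b] V where
  toFun x := ∑ i, toPuiseux b (x i) • e i
  map_add' x y := by simp only [Pi.add_apply, map_add, add_smul, Finset.sum_add_distrib]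
  map_smul' f x := by
    simp only [Pi.smul_apply, smul_eq_mul, map_mul, mul_smul, Finset.smul_sum]

theorem combination_apply (e : Module.Basis σ Puiseux V) (b : ℕ+) (x : σ → LaurentSeries ℂ) :
    combination e b x = ∑ i, toPuiseux b (x i) • e i :=
  rfl

theorem combination_ne_zero (e : Module.Basis σ Puiseux V) (b : ℕ+) {x : σ → LaurentSeries ℂ}
    (hx : x ≠ 0) : combination e b x ≠ 0 := fun h => hx <| funext fun i =>
  (toPuiseux b).injective <| by
    rw [Pi.zero_apply, map_zero]
    exact Fintype.linearIndependent_iff.mp e.linearIndependent _ h i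

variable {e : Module.Basis σ Puiseux V} {D : DifferentialOperator Puiseux V} {b : ℕ+} {p : Puiseux}
  {B : Matrix σ σ Puiseux} {g : LaurentSeries ℂ} {A : Matrix σ σ (LaurentSeries ℂ)}

/-- In the coordinates of a basis, a multiple of a differential operator is a system. -/
theorem smul_map_combination (he : ∀ j, p • D (e j) = ∑ i, B i j • e i) (hg : toPuiseux b g = p)
    (hA : ∀ i j, toPuiseux b (A i j) = B i j) (x : σ → LaurentSeries ℂ) :
    p • D (combination e b x) = combination e b (systemOp b g A x) := by
  have h1 : D (combination e b x) = ∑ j, (toPuiseux b (x j) • D (e j) +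
      toPuiseux b (eulerRoot b (x j)) • e j) := by
    rw [combination_apply, map_sum]
    refine Finset.sum_congr rfl fun j _ => ?_
    rw [map_smul_eq, deriv_toPuiseux]
  have h2 : ∀ j, p • (toPuiseux b (x j) • D (e j) + toPuiseux b (eulerRoot b (x j)) • e j) =
      ∑ i, toPuiseux b (A i j * x j) • e i + toPuiseux b (g * eulerRoot b (x j)) • e j := by
    intro j
    rw [smul_add, smul_comm p, he, Finset.smul_sum, smul_smul, map_mul, hg]
    congr 1
    refine Finset.sum_congr rfl fun i _ => ?_
    rw [smul_smul, map_mul, hA, mul_comm]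
  rw [h1, Finset.smul_sum, Finset.sum_congr rfl fun j _ => h2 j, Finset.sum_add_distrib,
    Finset.sum_comm, combination_apply, ← Finset.sum_add_distrib]
  refine Finset.sum_congr rfl fun i _ => ?_
  rw [systemOp_apply, map_add, add_smul, map_sum, Finset.sum_smul, add_comm]

theorem exists_generators_of_ne_top {F : Type*} [Field F] {W : Submodule F (σ → F)} (h : W ≠ ⊤) :
    ∃ (m : ℕ) (w : Fin m → σ → F), m < Fintype.card σ ∧
      ∀ x ∈ W, ∃ c : Fin m → F, x = ∑ i, c i • w i := by
  let w := Module.finBasis F W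
  refine ⟨_, fun i => w i, ?_, fun x hx => ⟨w.repr ⟨x, hx⟩, ?_⟩⟩
  · have := Submodule.finrank_lt h
    rwa [Module.finrank_fintype_fun_eq_card] at this
  · have := congrArg Subtype.val (w.sum_repr ⟨x, hx⟩)
    rw [Submodule.coe_sum] at this
    exact this.symm

/-- A stable subspace in coordinates over `ℂ((t^{1/b}))` generates one over the Puiseux series. -/
theorem not_isIrreducible_of_stable (hp : p ≠ 0)
    (he : ∀ j, p • D (e j) = ∑ i, B i j • e i) (hg : toPuiseux b g = p)
    (hA : ∀ i j, toPuiseux b (A i j) = B i j)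
    {W : Submodule (LaurentSeries ℂ) (σ → LaurentSeries ℂ)} (hbot : W ≠ ⊥) (htop : W ≠ ⊤)
    (hW : ∀ x ∈ W, systemOp b g A x ∈ W) : ¬ D.IsIrreducible := by
  intro hD
  let U : Submodule Puiseux V := Submodule.span Puiseux (combination e b '' W)
  have hU : ∀ x ∈ U, D x ∈ U := by
    refine fun x hx => D.map_mem_of_mem_span ?_ hx
    rintro _ ⟨x, hx, rfl⟩
    refine ⟨Submodule.subset_span ⟨x, hx, rfl⟩, ?_⟩
    rw [← inv_smul_smul₀ hp (D _), smul_map_combination he hg hA]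
    exact U.smul_mem _ (Submodule.subset_span ⟨_, hW x hx, rfl⟩)
  rcases hD U hU with h | h
  · obtain ⟨x, hx, hx0⟩ := Submodule.exists_mem_ne_zero_of_ne_bot hbot
    refine combination_ne_zero e b hx0 ?_
    rw [← Submodule.mem_bot Puiseux, ← h]
    exact Submodule.subset_span ⟨x, hx, rfl⟩
  · obtain ⟨m, w, hm, hw⟩ := exists_generators_of_ne_top htop
    have hle : U ≤ Submodule.span Puiseux (Set.range fun i => combination e b (w i)) := by
      rw [Submodule.span_le]
      rintro _ ⟨x, hx, rfl⟩
      obtain ⟨c, rfl⟩ := hw x hx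
      rw [map_sum]
      refine Submodule.sum_mem _ fun i _ => ?_
      rw [map_smulₛₗ]
      exact Submodule.smul_mem _ _ (Submodule.subset_span ⟨i, rfl⟩)
    have h1 := finrank_range_le_card (R := Puiseux) fun i => combination e b (w i)
    have h2 : Module.finrank Puiseux V = Fintype.card σ := Module.finrank_eq_card_basis e
    have h3 : Submodule.span Puiseux (Set.range fun i => combination e b (w i)) = ⊤ :=
      top_le_iff.mp (h ▸ hle)
    rw [Set.finrank, h3, finrank_top, h2, Fintype.card_fin] at h1
    omega

theorem coeff_eq_zero_of_toPuiseux {f : LaurentSeries ℂ} {x : Puiseux} (hf : toPuiseux b f = x)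
    (hx : ∀ q < 0, (x : HahnSeries ℚ ℂ).coeff q = 0) (m : ℤ) (hm : m < 0) : f.coeff m = 0 := by
  rw [← coeff_toPuiseux b, hf]
  refine hx _ (mul_neg_of_pos_of_neg ?_ (by exact_mod_cast hm))
  exact inv_pos.mpr (by exact_mod_cast b.pos)

/-- An operator that preserves a lattice has an eigenvalue. -/
theorem exists_isEigenvalue_of_integral [Nonempty σ] (he : ∀ j, D (e j) = ∑ i, B i j • e i)
    (hB : ∀ i j, ∀ q < 0, (B i j : HahnSeries ℚ ℂ).coeff q = 0) : ∃ a, D.IsEigenvalue a := by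
  classical
  obtain ⟨b, f, hf⟩ := exists_common_denominator fun ij : σ × σ => B ij.1 ij.2
  let A : Matrix σ σ (LaurentSeries ℂ) := fun i j => f (i, j)
  have hA : ∀ i j, toPuiseux b (A i j) = B i j := fun i j => hf (i, j)
  obtain ⟨c, x, hx0, hx⟩ := exists_eigenvector_of_integral b (A := A)
    fun i j => coeff_eq_zero_of_toPuiseux (hA i j) (hB i j)
  refine ⟨toPuiseux b (HahnSeries.C c), combination e b x, combination_ne_zero e b hx0, ?_⟩
  have h := smul_map_combination (p := 1) (D := D) (fun j => (one_smul _ _).trans (he j))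
    (map_one (toPuiseux b)) hA x
  rw [one_smul, hx, map_smulₛₗ] at h
  exact h

/-- A lattice on which `t^ρ D`, with `ρ > 0`, acts with a residue of trace zero that is not
nilpotent gives rise to a stable subspace. -/
theorem not_isIrreducible_of_trace_eq_zero [Nonempty σ] [DecidableEq σ] {ρ : ℚ} (hρ : 0 < ρ)
    (he : ∀ j, tPow ρ • D (e j) = ∑ i, B i j • e i)
    (hB : ∀ i j, ∀ q < 0, (B i j : HahnSeries ℚ ℂ).coeff q = 0) {R : Matrix σ σ ℂ}
    (hR : ∀ i j, (B i j : HahnSeries ℚ ℂ).coeff 0 = R i j) (htr : R.trace = 0)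
    (hnil : ¬ IsNilpotent R) : ¬ D.IsIrreducible := by
  obtain ⟨b, f, hf⟩ := exists_common_denominator
    fun o : Option (σ × σ) => o.elim (tPow ρ) fun ij => B ij.1 ij.2
  let A : Matrix σ σ (LaurentSeries ℂ) := fun i j => f (some (i, j))
  have hA : ∀ i j, toPuiseux b (A i j) = B i j := fun i j => hf (some (i, j))
  have hg : toPuiseux b (f none) = tPow ρ := hf none
  have hres : residueMatrix A = R := by
    ext i j
    rw [← hR, ← hA]
    have h := coeff_toPuiseux b (A i j) 0
    rw [Int.cast_zero, mul_zero] at h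
    exact h.symm
  obtain ⟨W, hbot, htop, hW⟩ := exists_stable_submodule_of_trace_eq_zero b (g := f none) (A := A)
    (fun m hm => by
      rw [← coeff_toPuiseux b, hg, coe_tPow]
      refine HahnSeries.coeff_single_of_ne (ne_of_lt (lt_of_le_of_lt ?_ hρ))
      refine mul_nonpos_of_nonneg_of_nonpos (inv_nonneg.mpr (by positivity)) ?_
      exact_mod_cast Int.lt_add_one_iff.mp hm)
    (fun i j => coeff_eq_zero_of_toPuiseux (hA i j) (hB i j)) (hres ▸ htr) (hres ▸ hnil)
  exact not_isIrreducible_of_stable (tPow_ne_zero ρ) he hg hA hbot htop hW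

end Lattice

/-- The largest of the slopes `-ord(aᵢ) / dᵢ`, or `0` if they are all negative. -/
theorem exists_slope {α : Type*} [Finite α] (d : α → ℚ) (hd : ∀ i, 0 < d i)
    (a : α → HahnSeries ℚ ℂ) :
    ∃ ρ : ℚ, 0 ≤ ρ ∧ (∀ i, ∀ q < -(d i * ρ), (a i).coeff q = 0) ∧
      (0 < ρ → ∃ i, (a i).coeff (-(d i * ρ)) ≠ 0) := by
  classical
  obtain ⟨o, ho⟩ := Finite.exists_max fun o : Option α =>
    o.elim 0 fun i => if a i = 0 then 0 else -(a i).order / d i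
  refine ⟨_, ho none, fun i q hq => ?_, fun hpos => ?_⟩
  · have h := ho (some i)
    simp only [Option.elim_some] at h
    split_ifs at h with h0
    · rw [h0]
      rfl
    · rw [div_le_iff₀' (hd i)] at h
      exact HahnSeries.coeff_eq_zero_of_lt_order (by linarith)
  · rcases o with _ | i
    · exact absurd hpos (lt_irrefl _)
    · refine ⟨i, ?_⟩
      simp only [Option.elim_some] at hpos ⊢
      split_ifs at hpos ⊢ with h0
      · exact absurd hpos (lt_irrefl _)
      · rw [mul_div_cancel₀ _ (hd i).ne', neg_neg]
        exact HahnSeries.coeff_order_eq_zero.not.mpr h0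

/-- A companion matrix with nonzero last column is not nilpotent. -/
theorem not_isNilpotent_of_companion {n : ℕ} {R : Matrix (Fin (n + 1)) (Fin (n + 1)) ℂ}
    (hR : ∀ i (j : Fin n), R i j.castSucc = if i = j.succ then 1 else 0) {i : Fin (n + 1)}
    (hi : R i (Fin.last n) ≠ 0) : ¬ IsNilpotent R := by
  intro hnil
  have hN := (LinearMap.isNilpotent_iff_charpoly _).mp (Matrix.isNilpotent_toLin'_iff R |>.mpr hnil)
  have hpow : Matrix.toLin' R ^ (n + 1) = 0 := by
    have := LinearMap.aeval_self_charpoly (Matrix.toLin' R)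
    rw [hN] at this
    simpa using this
  have hcol : ∀ k (hk : k < n + 1), (Matrix.toLin' R ^ k) (Pi.single 0 1) =
      Pi.single (⟨k, hk⟩ : Fin (n + 1)) 1 := by
    intro k
    induction k with
    | zero => exact fun _ => rfl
    | succ k ih =>
      intro hk
      rw [pow_succ', Module.End.mul_apply, ih (by omega), Matrix.toLin'_apply,
        Matrix.mulVec_single_one]
      ext l
      have := hR l ⟨k, by omega⟩
      rw [Pi.single_apply]
      exact this
  have h := congrFun (LinearMap.congr_fun hpow (Pi.single 0 1)) i
  rw [pow_succ', Module.End.mul_apply, hcol n (Nat.lt_succ_self n), Matrix.toLin'_apply,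
    Matrix.mulVec_single_one] at h
  exact hi h

section Main

variable {V : Type*} [AddCommGroup V] [Module Puiseux V]

/-- An irreducible operator has an eigenvalue if the relation for `Dⁿ⁺¹ v` has no term of
index `n`. -/
theorem IsIrreducible.exists_isEigenvalue_of_mem_krylov {n : ℕ}
    {D : DifferentialOperator Puiseux V} (hD : D.IsIrreducible) {v : V}
    (e : Module.Basis (Fin (n + 1)) Puiseux V) (he : ∀ i, e i = D.iter v i)
    (hv : D.iter v (n + 1) ∈ D.krylov v n) : ∃ a, D.IsEigenvalue a := by
  let a : Fin (n + 1) → Puiseux := e.repr (D.iter v (n + 1))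
  have ha : ∑ i, a i • D.iter v i = D.iter v (n + 1) := by
    simp only [← he]
    exact e.sum_repr _
  have halast : a (Fin.last n) = 0 := by
    have hle : D.krylov v n ≤ LinearMap.ker (e.coord (Fin.last n)) := by
      refine krylov_le_iff.mpr fun i hi => ?_
      have : D.iter v i = e ⟨i, hi.trans (Nat.lt_succ_self n)⟩ := (he ⟨i, _⟩).symm
      rw [this, LinearMap.mem_ker, Module.Basis.coord_apply, Module.Basis.repr_self,
        Finsupp.single_apply, if_neg]
      exact fun h => hi.ne (congrArg Fin.val h)
    exact hle hv
  let d : Fin (n + 1) → ℚ := fun i => n + 1 - (i : ℕ)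
  have hd : ∀ i, 0 < d i := fun i => by
    have : ((i : ℕ) : ℚ) < n + 1 := by exact_mod_cast i.2
    exact sub_pos.mpr this
  obtain ⟨ρ, hρ0, hρ, hρ'⟩ := exists_slope d hd fun i => (a i : HahnSeries ℚ ℂ)
  -- the lattice spanned by the vectors `t^{iρ} Dⁱ v`
  let e' : Module.Basis (Fin (n + 1)) Puiseux V :=
    e.unitsSMul fun i => Units.mk0 (tPow ((i : ℕ) * ρ)) (tPow_ne_zero _)
  have he' : ∀ i, e' i = tPow ((i : ℕ) * ρ) • D.iter v i := fun i => by
    rw [Module.Basis.unitsSMul_apply, he]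
    rfl
  -- the residue of `t^ρ D` on this lattice comes from the companion part `S` only, as the part due
  -- to differentiating `t^{jρ}` is divisible by `t^ρ`
  let S : Fin (n + 1) → Fin (n + 1) → Puiseux := fun i j =>
    Fin.lastCases (motive := fun _ => Puiseux) (tPow (d i * ρ) * a i)
      (fun j => if i = j.succ then 1 else 0) j
  have hSlast : ∀ i, S i (Fin.last n) = tPow (d i * ρ) * a i := fun i => Fin.lastCases_last
  have hScast : ∀ i (j : Fin n), S i j.castSucc = if i = j.succ then 1 else 0 :=
    fun i j => Fin.lastCases_castSucc _
  have hS : ∀ j : Fin (n + 1), tPow (((j : ℕ) + 1) * ρ) • D.iter v (j + 1) = ∑ i, S i j • e' i := by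
    intro j
    induction j using Fin.lastCases with
    | last =>
      rw [Fin.val_last, ← ha, Finset.smul_sum]
      refine Finset.sum_congr rfl fun i _ => ?_
      rw [hSlast, he', smul_smul, smul_smul, mul_right_comm, tPow_mul, ← add_mul, sub_add_cancel]
    | cast j =>
      rw [Finset.sum_eq_single j.succ]
      · rw [hScast, if_pos rfl, one_smul, he', Fin.val_succ, Fin.val_castSucc]
        push_cast
        rfl
      · intro i _ hi
        rw [hScast, if_neg hi, zero_smul]
      · exact fun h => absurd (Finset.mem_univ _) h
  let B : Matrix (Fin (n + 1)) (Fin (n + 1)) Puiseux := fun i j =>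
    (if i = j then tPow ρ * (((j : ℕ) * ρ : ℚ) : Puiseux) else 0) + S i j
  have hB : ∀ j, tPow ρ • D (e' j) = ∑ i, B i j • e' i := by
    intro j
    simp only [B, add_smul, Finset.sum_add_distrib, ite_smul, zero_smul, Finset.sum_ite_eq',
      Finset.mem_univ, if_true]
    rw [← hS, he', map_smul_eq, deriv_tPow, ← iter_succ, smul_add, smul_smul, smul_smul, smul_smul,
      tPow_mul, add_comm]
    congr 2
    · rw [mul_assoc]
    · congr 1
      ring
  have hdiag : ∀ (j : ℕ) (q : ℚ), q < ρ →
      ((tPow ρ * ((j * ρ : ℚ) : Puiseux) : Puiseux) : HahnSeries ℚ ℂ).coeff q = 0 := by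
    intro j q hq
    rw [coeff_tPow_mul, coe_ratCast, HahnSeries.C_apply, HahnSeries.coeff_single_of_ne]
    exact (sub_neg.mpr hq).ne
  have hSint : ∀ i j, ∀ q < 0, (S i j : HahnSeries ℚ ℂ).coeff q = 0 := by
    intro i j q hq
    induction j using Fin.lastCases with
    | last =>
      rw [hSlast, coeff_tPow_mul]
      exact hρ i _ (by linarith)
    | cast j =>
      rw [hScast]
      split_ifs
      · exact HahnSeries.coeff_single_of_ne hq.ne
      · rfl
  have hBcoeff : ∀ i j, ∀ q < ρ, (B i j : HahnSeries ℚ ℂ).coeff q =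
      (S i j : HahnSeries ℚ ℂ).coeff q := by
    intro i j q hq
    rw [Subfield.coe_add, HahnSeries.coeff_add]
    split_ifs
    · rw [hdiag _ _ hq, zero_add]
    · exact zero_add _
  have hBint : ∀ i j, ∀ q < 0, (B i j : HahnSeries ℚ ℂ).coeff q = 0 := fun i j q hq => by
    rw [hBcoeff i j q (hq.trans_le hρ0), hSint i j q hq]
  rcases hρ0.eq_or_lt with h0 | hpos
  · refine exists_isEigenvalue_of_integral (e := e') (B := B) (fun j => ?_) hBint
    rw [← hB, ← h0, tPow_zero, one_smul]
  · obtain ⟨i, hi⟩ := hρ' hpos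
    have hRlast : ∀ i, (S i (Fin.last n) : HahnSeries ℚ ℂ).coeff 0 =
        (a i : HahnSeries ℚ ℂ).coeff (-(d i * ρ)) := fun i => by
      rw [hSlast, coeff_tPow_mul, zero_sub]
    have hRcast : ∀ i (j : Fin n), (S i j.castSucc : HahnSeries ℚ ℂ).coeff 0 =
        if i = j.succ then 1 else 0 := fun i j => by
      rw [hScast]
      split_ifs
      · exact HahnSeries.coeff_single_same 0 (1 : ℂ)
      · rfl
    refine absurd hD (not_isIrreducible_of_trace_eq_zero hpos hB hBint
      (R := Matrix.of fun i j => (S i j : HahnSeries ℚ ℂ).coeff 0)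
      (fun i j => hBcoeff i j 0 hpos) ?_
      (not_isNilpotent_of_companion hRcast (i := i) ((hRlast i).trans_ne hi)))
    refine Finset.sum_eq_zero fun j _ => ?_
    rw [Matrix.diag_apply, Matrix.of_apply]
    induction j using Fin.lastCases with
    | last =>
      rw [hRlast, halast]
      rfl
    | cast j =>
      rw [hRcast, if_neg]
      exact (Fin.castSucc_lt_succ).ne

theorem IsIrreducible.exists_isEigenvalue [FiniteDimensional Puiseux V] [Nontrivial V]
    {D : DifferentialOperator Puiseux V} (hD : D.IsIrreducible) : ∃ a, D.IsEigenvalue a := by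
  obtain ⟨v, hv⟩ := exists_ne (0 : V)
  obtain ⟨n, hn⟩ : ∃ n, Module.finrank Puiseux V = n + 1 :=
    ⟨_, (Nat.succ_pred_eq_of_pos Module.finrank_pos).symm⟩
  obtain ⟨f, hf⟩ : ∃ f, (D.twist f).iter v (n + 1) ∈ (D.twist f).krylov v n := by
    refine D.exists_iter_twist_mem_krylov v ?_
    obtain ⟨e, he⟩ := hD.exists_basis hv hn
    have : D.krylov v (n + 1) = ⊤ := by
      rw [← e.span_eq, krylov]
      exact congrArg _ (congrArg Set.range (funext fun i => (he i).symm))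
    exact this ▸ Submodule.mem_top
  obtain ⟨e, he⟩ := (hD.twist f).exists_basis hv hn
  obtain ⟨a, x, hx0, hx⟩ := (hD.twist f).exists_isEigenvalue_of_mem_krylov e he hf
  refine ⟨a + f, x, hx0, ?_⟩
  rw [twist_apply, sub_eq_iff_eq_add] at hx
  rw [hx, add_smul]

/-- The restriction of `D` to an invariant subspace. -/
def restrict (D : DifferentialOperator Puiseux V) (W : Submodule Puiseux V)
    (hW : ∀ x ∈ W, D x ∈ W) : DifferentialOperator Puiseux W where
  toAddMonoidHom := (D.toAddMonoidHom.comp W.subtype.toAddMonoidHom).codRestrict W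
    fun x => hW x x.2
  leibniz a v := Subtype.ext (D.leibniz a v)

/-- Every differential operator over the Puiseux series has an eigenvalue. -/
theorem exists_isEigenvalue [FiniteDimensional Puiseux V] [Nontrivial V]
    (D : DifferentialOperator Puiseux V) : ∃ a, D.IsEigenvalue a := by
  induction hn : Module.finrank Puiseux V using Nat.strong_induction_on generalizing V with
  | _ n ih =>
    by_cases hD : D.IsIrreducible
    · exact hD.exists_isEigenvalue
    · simp only [IsIrreducible, not_forall, not_or] at hD
      obtain ⟨W, hW, hbot, htop⟩ := hD
      have : Nontrivial W := Submodule.nontrivial_iff_ne_bot.mpr hbot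
      obtain ⟨a, x, hx0, hx⟩ := ih _ (hn ▸ Submodule.finrank_lt htop) (D.restrict W hW) rfl
      exact ⟨a, x, fun h => hx0 (Subtype.ext h), congrArg Subtype.val hx⟩

end Main

/-! ### Descent to a finite extension -/

section Descent

open scoped TensorProduct

variable {V : Type*} [AddCommGroup V] [Module K V] {σ : Type*} [Fintype σ]

/-- The operator `x ↦ d(x) + A x` on tuples of Puiseux series, for a matrix `A` over `ℂ((t))`. -/
def ofMatrix (A : Matrix σ σ (LaurentSeries ℂ)) : DifferentialOperator Puiseux (σ → Puiseux) where
  toAddMonoidHom := AddMonoidHom.mk'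
    (fun x i => Differential.deriv (x i) + ∑ j, toPuiseux 1 (A i j) * x j) (fun x y => by
      ext1 i
      simp only [Pi.add_apply, map_add, mul_add, Finset.sum_add_distrib]
      abel)
  leibniz c x := by
    ext1 i
    simp only [AddMonoidHom.mk'_apply, Pi.add_apply, Pi.smul_apply, smul_eq_mul,
      Derivation.leibniz, mul_add, Finset.mul_sum, mul_left_comm c, mul_comm (x i)]
    ring

theorem ofMatrix_apply (A : Matrix σ σ (LaurentSeries ℂ)) (x : σ → Puiseux) (i : σ) :
    ofMatrix A x i = Differential.deriv (x i) + ∑ j, toPuiseux 1 (A i j) * x j :=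
  rfl

theorem toPuiseux_inclusion (b : ℕ+) (f : LaurentSeries ℂ) :
    toPuiseux b (inclusion b f) = toPuiseux 1 f :=
  Subtype.ext (by
    rw [coe_toPuiseux, coe_toPuiseux, ← puiseuxHom_mul_inclusion 1 b, one_mul])

theorem baseChange_sum_tmul (D : DifferentialOperator K V) (e : Module.Basis σ K V) (b : ℕ+)
    (y : σ → Kb b) : D.baseChange b (∑ j, y j ⊗ₜ[K] e j) =
      ∑ i, (Differential.deriv (y i) + ∑ j, algebraMap K (Kb b) (e.repr (D (e j)) i) * y j)
        ⊗ₜ[K] e i := by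
  have h : ∀ j, D.baseChange b (y j ⊗ₜ[K] e j) = Differential.deriv (y j) ⊗ₜ[K] e j +
      ∑ i, (algebraMap K (Kb b) (e.repr (D (e j)) i) * y j) ⊗ₜ[K] e i := by
    intro j
    refine (D.baseChangeHom_tmul b (y j) (e j)).trans ?_
    congr 1
    conv_lhs => rw [← e.sum_repr (D (e j)), TensorProduct.tmul_sum]
    refine Finset.sum_congr rfl fun i _ => ?_
    rw [← Algebra.smul_def]
    exact (TensorProduct.smul_tmul _ _ _).symm
  rw [map_sum, Finset.sum_congr rfl fun j _ => h j, Finset.sum_add_distrib, Finset.sum_comm,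
    ← Finset.sum_add_distrib]
  refine Finset.sum_congr rfl fun i _ => ?_
  rw [TensorProduct.add_tmul, TensorProduct.sum_tmul]

theorem sum_tmul_ne_zero (e : Module.Basis σ K V) (b : ℕ+) {y : σ → Kb b} (hy : y ≠ 0) :
    ∑ j, y j ⊗ₜ[K] e j ≠ 0 := fun h => hy <| funext <| by
  refine Fintype.linearIndependent_iff.mp
    (Algebra.TensorProduct.basis (Kb b) e).linearIndependent y ?_
  rw [← h]
  refine Finset.sum_congr rfl fun j _ => ?_
  rw [Algebra.TensorProduct.basis_apply, TensorProduct.smul_tmul', smul_eq_mul, mul_one]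

end Descent

end DifferentialOperator

end FormalDiff

end

/-- Every formal differential operator on a nonzero finite-dimensional vector space over `ℂ((t))`
has an eigenvalue after base change to some `ℂ((t^{1/b}))`. -/
theorem corollary1p10 {V : Type*} [AddCommGroup V] [Module FormalDiff.K V]
    [FiniteDimensional FormalDiff.K V] [Nontrivial V]
    (D : FormalDiff.DifferentialOperator FormalDiff.K V) :
    ∃ (b : ℕ+) (a : FormalDiff.Kb b), (D.baseChange b).IsEigenvalue a := by
  open FormalDiff FormalDiff.DifferentialOperator in
  let e := Module.finBasis K V
  have : Nonempty (Fin (Module.finrank K V)) := ⟨⟨0, Module.finrank_pos⟩⟩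
  let A : Matrix (Fin (Module.finrank K V)) (Fin (Module.finrank K V)) (LaurentSeries ℂ) :=
    fun i j => e.repr (D (e j)) i
  obtain ⟨a, x, hx0, hx⟩ := exists_isEigenvalue (ofMatrix A)
  obtain ⟨b, f, hf⟩ := exists_common_denominator fun o : Option _ => o.elim a x
  let y : Fin (Module.finrank K V) → Kb b := fun i => f (some i)
  let c : Kb b := f none
  have hxy : ∀ i, toPuiseux b (f (some i)) = x i := fun i => hf (some i)
  have hfa : toPuiseux b (f none) = a := hf none
  have key : ∀ i, eulerRoot b (f (some i)) + ∑ j, inclusion b (A i j) * f (some j) =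
      f none * f (some i) := by
    intro i
    apply (toPuiseux b).injective
    have h := congrFun hx i
    rw [ofMatrix_apply, Pi.smul_apply, smul_eq_mul] at h
    simp only [map_add, map_sum, map_mul, toPuiseux_inclusion, hxy, hfa, ← deriv_toPuiseux]
    exact h
  refine ⟨b, c, ∑ j, TensorProduct.tmul K (y j) (e j), sum_tmul_ne_zero e b fun hy => hx0 ?_,
    (baseChange_sum_tmul D e b y).trans ?_⟩
  · ext1 i
    rw [← hxy]
    exact (congrArg (toPuiseux b) (congrFun hy i)).trans (map_zero _)
  · rw [Finset.smul_sum]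
    refine Finset.sum_congr rfl fun i _ => ?_
    rw [TensorProduct.smul_tmul', smul_eq_mul]
    exact congrArg (fun r : Kb b => TensorProduct.tmul K r (e i)) (key i)
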